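/- Let $(Q,I)$ be a finite connected bound quiver with at least one arrow, and $A=KQ/I$. Paths are written from left to right. It is \emph{locally gentle} if $I$ is generated by paths of length $2$, every vertex has in-degree and out-degree at most $2$, and for every arrow $\alpha$ there is at most one arrow $\beta$ with $t(\beta)=s(\alpha)$, $\beta\alpha\in I$, at most one with $t(\beta)=s(\alpha)$, $\beta\alpha\notin I$, at most one with $s(\beta)=t(\alpha)$, $\alpha\beta\in I$, and at most one with $s(\beta)=t(\alpha)$, $\alpha\beta\notin I$. A path of positive length is a \emph{path in $A$} if it is not in $I$; it is an \emph{antipath} if any two consecutive arrows of it compose to an element of $I$. An \emph{anticycle} (resp. \emph{oriented cycle}) is a closed path $\alpha_1\cdots\alpha_l$, $l\ge 1$, all of whose cyclically consecutive products $\alpha_i\alpha_{i+1}$ are in $I$ (resp. not in $I$), with pairwise distinct arrows; it is considered up to rotation. $(Q,I)$ is \emph{gentle} if it is locally gentle and has no oriented cycle. A \emph{blossoming} of a locally gentle $(Q,I)$ (the connectedness of $Q$ and the existence of an arrow are not needed here) is obtained by adding, at each vertex $v$, $2-d_{\mathrm{in}}(v)$ arrows into $v$ from new pairwise distinct source vertices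 and $2-d_{\mathrm{out}}(v)$ arrows from $v$ to new pairwise distinct sink vertices, and adding relations of length $2$ involving new arrows so that the result is again locally gentle. For gentle $(Q,I)$ label the new sources $s_1,\dots,s_d$ and new sinks $t_1,\dots,t_d$ so that $s_p$ and $t_p$ are joined by a maximal path $\sigma_p\wp_p\tau_p$, where $\sigma_p$ is the arrow starting at $s_p$ and $\tau_p$ the arrow ending at $t_p$. The maximal antipath of the blossoming ending at $t_p$ has the form $\sigma_{\Phi(p)}\delta_p\tau_p$, with $\Phi$ a permutation of $\{1,\dots,d\}$ and $\delta_p$ an antipath of $A$ or of length $0$. The \emph{AG-orbits} of $A$ are the orbits $\mathcal O$ of $\Phi$ on $\{\delta_1,\dots,\delta_d\}$ (with $\Phi(\delta_p)=\delta_{\Phi(p)}$), and the \emph{type} of $\mathcal O$ is $(|\mathcal O|,\sum_{\delta_p\in\mathcal O}\mathrm{length}(\delta_p))$. Let $\phi_A(0,l)$ be the number of anticycles of length $l$, and for $q\ge1$ let $\phi_A(q,l)$ be the number of AG-orbits of type $(q,l)$. For $k\ge 1$ the \emph{$k$-fold gentle repetition} $(Q^{(k)},I^{(k)})$, $A^{(k)}=KQ^{(k)}/I^{(k)}$,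 has vertices $a^{[i]}$ $(a\in Q_0,\ 1\le i\le k)$ and arrows $\alpha^{[i]}:s(\alpha)^{[i]}\to t(\alpha)^{[i]}$ $(\alpha\in Q_1,\ 1\le i\le k)$ and $\varpi_p^{[i]}:s(\tau_p)^{[i]}\to t(\sigma_p)^{[i+1]}$ $(1\le p\le d,\ 1\le i<k)$. Its relations are $\alpha^{[i]}\beta^{[i]}$ for $\alpha\beta\in I$, $\alpha^{[i]}\varpi_p^{[i]}$ if $\alpha\tau_p$ is a relation of the blossoming, $\varpi_p^{[i]}\alpha^{[i+1]}$ if $\sigma_p\alpha$ is one, and $\varpi_p^{[i]}\varpi_{r}^{[i+1]}$ if $\sigma_p\tau_{r}$ is one. Let $(Q,I)$ be gentle and $k\ge1$. Then $(Q,I)$ has a blossoming and, for every choice of it, $(Q^{(k)},I^{(k)})$ is gentle and has a blossoming; and for every choice of the two blossomings the following hold. (1) The map $(i,\omega)\mapsto\omega^{[i]}$ is, for each $l$, a bijection from $\{1,\dots,k\}\times\{\text{anticycles of }A\text{ of length }l\}$ onto the anticycles of $A^{(k)}$ of length $l$. (2) There is a bijection $e$ between the labels of the blossom vertices of $Q$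 and those of $Q^{(k)}$, under which the targets of the arrows $\sigma$ and the sources of the arrows $\tau$ for $Q^{(k)}$ are the copies, in sheet $1$ and in sheet $k$ respectively, of those for $Q$, such that (identifying AG-orbits with sets of labels) the image of each AG-orbit of $A$ of type $(q,l)$ contains exactly $\gcd(q,k)$ AG-orbits of $A^{(k)}$, each of type $$\Big(\frac{L}{k},\ \frac{L}{q}\,l+\frac{L}{k}(k-1)\Big),\qquad L=\mathrm{lcm}(q,k),$$ and every AG-orbit of $A^{(k)}$ is contained in the image of exactly one AG-orbit of $A$. (3) For all integers $n\ge 1$, $m\ge 0$, the set $$S_{(k)}(n,m)=\Big\{(q,l)\ \Big|\ q\ge1,\ l\ge0,\ (n,m)=\Big(\frac{L}{k},\frac{L}{q}l+\frac{L}{k}(k-1)\Big),\ L=\mathrm{lcm}(q,k)\Big\}$$ is finite and $$\phi_{A^{(k)}}(n,m)=\sum_{(q,l)\in S_{(k)}(n,m)}\gcd(q,k)\,\phi_A(q,l).$$ (4) For all $l\ge 0$, $\phi_{A^{(k)}}(0,l)=k\,\phi_A(0,l)$. -/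

import Mathlib

universe u v

/-- A finite quiver with quadratic monomial relations: vertices `V`, arrows `E`, source and target
maps `s`, `t`, and the set of those paths `αβ` of length two (first `α`, then `β`) that lie in the
ideal `I`.  The ideal `I` is the one generated by these paths, so that a path of any length lies in
`I` exactly when two consecutive arrows of it form a path `αβ` with `rel α β`. -/
structure BoundQuiver where
  V : Type u
  E : Type v
  finV : Finite V
  finE : Finite E
  s : E → V
  t : E → V
  rel : E → E → Prop
  rel_comp : ∀ α β, rel α β → t α = s β

namespace BoundQuiver

attribute [instance] BoundQuiver.finV BoundQuiver.finE

/-- The composite `αβ` is defined and does not lie in `I`. -/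
def Nonzero (B : BoundQuiver.{u, v}) (α β : B.E) : Prop := B.t α = B.s β ∧ ¬ B.rel α β

noncomputable def inDeg (B : BoundQuiver.{u, v}) (a : B.V) : ℕ := Nat.card {α : B.E // B.t α = a}

noncomputable def outDeg (B : BoundQuiver.{u, v}) (a : B.V) : ℕ := Nat.card {α : B.E // B.s α = a}

/-- A path of positive length in `A = KQ/I`, i.e. a path of `Q` which is not in `I`. -/
def IsPath (B : BoundQuiver.{u, v}) (l : List B.E) : Prop := l ≠ [] ∧ l.IsChain B.Nonzero

/-- An antipath of positive length. -/
def IsAntipath (B : BoundQuiver.{u, v}) (l : List B.E) : Prop := l ≠ [] ∧ l.IsChain B.rel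

def IsMaximalPath (B : BoundQuiver.{u, v}) (l : List B.E) : Prop :=
  B.IsPath l ∧ ∀ α, ¬ B.IsPath (α :: l) ∧ ¬ B.IsPath (l ++ [α])

def IsMaximalAntipath (B : BoundQuiver.{u, v}) (l : List B.E) : Prop :=
  B.IsAntipath l ∧ ∀ α, ¬ B.IsAntipath (α :: l) ∧ ¬ B.IsAntipath (l ++ [α])

/-- A primitive oriented cycle in `A`, taken up to rotation. -/
def IsOrientedCycle (B : BoundQuiver.{u, v}) (c : Cycle B.E) : Prop :=
  c ≠ Cycle.nil ∧ c.Nodup ∧ c.Chain B.Nonzero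

/-- A primitive anticycle in `A`, taken up to rotation. -/
def IsAnticycle (B : BoundQuiver.{u, v}) (c : Cycle B.E) : Prop :=
  c ≠ Cycle.nil ∧ c.Nodup ∧ c.Chain B.rel

/-- The degree conditions and the conditions on relations of a locally gentle bound quiver. -/
structure IsLocallyGentle (B : BoundQuiver.{u, v}) : Prop where
  inDeg_le : ∀ a, B.inDeg a ≤ 2
  outDeg_le : ∀ a, B.outDeg a ≤ 2
  pre_rel : ∀ α, {β | B.t β = B.s α ∧ B.rel β α}.Subsingleton
  pre_nonzero : ∀ α, {β | B.t β = B.s α ∧ ¬ B.rel β α}.Subsingleton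
  post_rel : ∀ α, {β | B.t α = B.s β ∧ B.rel α β}.Subsingleton
  post_nonzero : ∀ α, {β | B.t α = B.s β ∧ ¬ B.rel α β}.Subsingleton

/-- The underlying graph is connected. -/
def IsConnected (B : BoundQuiver.{u, v}) : Prop :=
  Nonempty B.V ∧ ∀ a b : B.V, Relation.EqvGen (fun x y => ∃ α, B.s α = x ∧ B.t α = y) a b

/-- A gentle bound quiver: connected, with at least one arrow, locally gentle, and without oriented
cycles in `A`. -/
structure IsGentle (B : BoundQuiver.{u, v}) : Prop where
  connected : B.IsConnected
  nonempty_arrows : Nonempty B.E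
  locallyGentle : B.IsLocallyGentle
  no_cycle : ∀ c, ¬ B.IsOrientedCycle c

/-- Data for adding to `B` source blossom vertices `s_p` and sink blossom vertices `t_p`
(`p : Fin d`), with one arrow `σ_p` from `s_p` to `sigT p` and one arrow `τ_p` from `tauS p` to
`t_p`, together with the length-two relations among all arrows. Old vertices (arrows) are
`Sum.inl _`, the `s_p` (the `σ_p`) are `Sum.inr (Sum.inl p)`, the `t_p` (the `τ_p`) are
`Sum.inr (Sum.inr p)`. -/
structure BlossomData (B : BoundQuiver.{u, v}) where
  d : ℕ
  sigT : Fin d → B.V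
  tauS : Fin d → B.V
  rel : B.E ⊕ (Fin d ⊕ Fin d) → B.E ⊕ (Fin d ⊕ Fin d) → Prop
  rel_comp : ∀ x y, rel x y →
    Sum.elim (fun α => Sum.inl (B.t α))
        (Sum.elim (fun p => Sum.inl (sigT p)) (fun p => Sum.inr (Sum.inr p))) x =
      (Sum.elim (fun α => Sum.inl (B.s α))
        (Sum.elim (fun p => Sum.inr (Sum.inl p)) (fun p => Sum.inl (tauS p))) y :
          B.V ⊕ (Fin d ⊕ Fin d))

namespace BlossomData

variable {B : BoundQuiver.{u, v}}

/-- The enlarged bound quiver. -/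
def quiver (X : BlossomData B) : BoundQuiver.{u, v} where
  V := B.V ⊕ (Fin X.d ⊕ Fin X.d)
  E := B.E ⊕ (Fin X.d ⊕ Fin X.d)
  finV := inferInstance
  finE := inferInstance
  s := Sum.elim (fun α => Sum.inl (B.s α))
        (Sum.elim (fun p => Sum.inr (Sum.inl p)) (fun p => Sum.inl (X.tauS p)))
  t := Sum.elim (fun α => Sum.inl (B.t α))
        (Sum.elim (fun p => Sum.inl (X.sigT p)) (fun p => Sum.inr (Sum.inr p)))
  rel := X.rel
  rel_comp := X.rel_comp

/-- An old arrow, as an arrow of the enlarged quiver. -/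
def old (X : BlossomData B) (α : B.E) : X.quiver.E := Sum.inl α

/-- The blossom arrow `σ_p`. -/
def sig (X : BlossomData B) (p : Fin X.d) : X.quiver.E := Sum.inr (Sum.inl p)

/-- The blossom arrow `τ_p`. -/
def tau (X : BlossomData B) (p : Fin X.d) : X.quiver.E := Sum.inr (Sum.inr p)

end BlossomData

/-- A (labelled) blossoming of `B`: every old vertex gets in-degree and out-degree two (that is,
`2 - inDeg` incoming and `2 - outDeg` outgoing arrows are added), the result is locally gentle, its
relations restrict to those of `B`, and the labels are such that `s_p` and `t_p` are joined by a
maximal path `σ_p ℘_p τ_p`. -/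
structure Blossoming (B : BoundQuiver.{u, v}) extends BlossomData B where
  rel_old : ∀ α β : B.E,
    toBlossomData.quiver.rel (toBlossomData.old α) (toBlossomData.old β) ↔ B.rel α β
  inDeg_two : ∀ a : B.V, toBlossomData.quiver.inDeg (Sum.inl a) = 2
  outDeg_two : ∀ a : B.V, toBlossomData.quiver.outDeg (Sum.inl a) = 2
  gentle : toBlossomData.quiver.IsLocallyGentle
  label : ∀ p : Fin d, ∃ w : List B.E, toBlossomData.quiver.IsMaximalPath
    (toBlossomData.sig p :: (w.map toBlossomData.old ++ [toBlossomData.tau p]))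

namespace Blossoming

variable {B : BoundQuiver.{u, v}}

/-- `Δ = σ_r δ τ_p` is a maximal antipath of the blossoming. -/
def IsDel (X : B.Blossoming) (p r : Fin X.d) (δ : List B.E) : Prop :=
  X.quiver.IsMaximalAntipath (X.sig r :: (δ.map X.old ++ [X.tau p]))

theorem old_inj (X : B.Blossoming) {a b : B.E} (h : X.old a = X.old b) : a = b :=
  Sum.inl.inj h

theorem sig_inj (X : B.Blossoming) {p q : Fin X.d} (h : X.sig p = X.sig q) : p = q :=
  Sum.inl.inj (Sum.inr.inj h)

theorem tau_inj (X : B.Blossoming) {p q : Fin X.d} (h : X.tau p = X.tau q) : p = q :=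
  Sum.inr.inj (Sum.inr.inj h)

theorem sig_ne_old (X : B.Blossoming) (p : Fin X.d) (a : B.E) : X.sig p ≠ X.old a :=
  fun h => nomatch h

theorem tau_ne_old (X : B.Blossoming) (p : Fin X.d) (a : B.E) : X.tau p ≠ X.old a :=
  fun h => nomatch h

theorem tau_ne_sig (X : B.Blossoming) (p q : Fin X.d) : X.tau p ≠ X.sig q :=
  fun h => nomatch h

theorem not_rel_sig (X : B.Blossoming) (x : X.quiver.E) (r : Fin X.d) :
    ¬ X.quiver.rel x (X.sig r) := by
  intro h
  have := X.quiver.rel_comp _ _ h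
  rcases x with a | p | p <;> simp [BlossomData.quiver, BlossomData.sig] at this

theorem not_tau_rel (X : B.Blossoming) (x : X.quiver.E) (p : Fin X.d) :
    ¬ X.quiver.rel (X.tau p) x := by
  intro h
  have := X.quiver.rel_comp _ _ h
  rcases x with a | q | q <;> simp [BlossomData.quiver, BlossomData.tau] at this

theorem exists_pre (X : B.Blossoming) (x : X.quiver.E) :
    (∃ r, x = X.sig r) ∨ ∃ y, X.quiver.rel y x := by
  by_cases hx : ∃ r, x = X.sig r
  · exact Or.inl hx
  right
  obtain ⟨v, hv⟩ : ∃ v : B.V, X.quiver.s x = Sum.inl v := by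
    rcases x with a | p | p
    · exact ⟨_, rfl⟩
    · exact absurd ⟨p, rfl⟩ hx
    · exact ⟨_, rfl⟩
  have h2 := X.inDeg_two v
  unfold inDeg at h2
  have : Nontrivial {α : X.quiver.E // X.quiver.t α = Sum.inl v} := by
    rw [← Finite.one_lt_card_iff_nontrivial, h2]; norm_num
  obtain ⟨⟨y, hy⟩, ⟨z, hz⟩, hyz⟩ := exists_pair_ne {α : X.quiver.E // X.quiver.t α = Sum.inl v}
  by_contra hcon
  push Not at hcon
  exact hyz (Subtype.ext (X.gentle.pre_nonzero x ⟨hy.trans hv.symm, hcon y⟩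
    ⟨hz.trans hv.symm, hcon z⟩))

theorem pre_unique (X : B.Blossoming) {x y z : X.quiver.E} (hy : X.quiver.rel y x)
    (hz : X.quiver.rel z x) : y = z :=
  X.gentle.pre_rel x ⟨X.quiver.rel_comp _ _ hy, hy⟩ ⟨X.quiver.rel_comp _ _ hz, hz⟩

theorem post_unique (X : B.Blossoming) {x y z : X.quiver.E} (hy : X.quiver.rel x y)
    (hz : X.quiver.rel x z) : y = z :=
  X.gentle.post_rel x ⟨X.quiver.rel_comp _ _ hy, hy⟩ ⟨X.quiver.rel_comp _ _ hz, hz⟩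

theorem isDel_iff (X : B.Blossoming) (p r : Fin X.d) (δ : List B.E) :
    X.IsDel p r δ ↔ (X.sig r :: (δ.map X.old ++ [X.tau p])).IsChain X.quiver.rel := by
  constructor
  · exact fun h => h.1.2
  · intro h
    refine ⟨⟨by simp, h⟩, fun α => ⟨fun hα => ?_, fun hα => ?_⟩⟩
    · exact X.not_rel_sig α r (List.isChain_cons_cons.1 hα.2).1
    · have h1 := hα.2
      rw [← List.cons_append, List.append_assoc, List.isChain_append] at h1
      exact X.not_tau_rel α p (List.isChain_cons_cons.1 h1.2.1).1

theorem exists_chain (X : B.Blossoming) (f : X.quiver.E → X.quiver.E)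
    (hf : ∀ x, (∃ r, x = X.sig r) ∨ X.quiver.rel (f x) x) (n : ℕ) :
    ∀ x, (∃ r, f^[n] x = X.sig r) → (∃ r, x = X.sig r) ∨
      ∃ (r : Fin X.d) (δ : List B.E), (X.sig r :: (δ.map X.old ++ [x])).IsChain X.quiver.rel := by
  induction n with
  | zero => exact fun x h => Or.inl h
  | succ n ih =>
    intro x hx
    rcases hf x with h | h
    · exact Or.inl h
    right
    rcases ih (f x) hx with ⟨r, hr⟩ | ⟨r, δ, hc⟩
    · refine ⟨r, [], ?_⟩
      rw [hr] at h
      simpa using h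
    · have hfx : ∃ a, f x = X.old a := by
        rcases hfx : f x with a | q | q
        · exact ⟨a, rfl⟩
        · exfalso
          rw [hfx, ← List.cons_append, List.isChain_append] at hc
          obtain ⟨z, hz⟩ : ∃ z, (X.sig r :: δ.map X.old).getLast? = some z :=
            ⟨_, List.getLast?_eq_getLast_of_ne_nil (by simp)⟩
          exact X.not_rel_sig z q (hc.2.2 z hz _ rfl)
        · rw [hfx] at h
          exact absurd h (X.not_tau_rel x q)
      obtain ⟨a, ha⟩ := hfx
      refine ⟨r, δ ++ [a], ?_⟩
      rw [ha] at hc h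
      rw [List.map_append, ← List.cons_append, List.isChain_append]
      refine ⟨by simpa using hc, by simp, ?_⟩
      intro z hz y hy
      simp only [List.head?_cons, Option.mem_def, Option.some.injEq] at hy
      subst hy
      have : z = X.old a := by
        rw [List.map_singleton, ← List.cons_append, List.getLast?_append] at hz
        simpa using hz.symm
      rw [this]; exact h

/-- For every `p` there is a maximal antipath of the blossoming ending with `τ_p`. -/
theorem exists_isDel (X : B.Blossoming) (p : Fin X.d) : ∃ r δ, X.IsDel p r δ := by
  have hf : ∀ x, ∃ y, (∃ r, x = X.sig r) ∨ X.quiver.rel y x := by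
    intro x
    rcases X.exists_pre x with h | ⟨y, h⟩
    · exact ⟨x, Or.inl h⟩
    · exact ⟨y, Or.inr h⟩
  choose f hf using hf
  have key : ∃ n, ∃ r, f^[n] (X.tau p) = X.sig r := by
    by_contra hcon
    push Not at hcon
    have hrel : ∀ n, X.quiver.rel (f^[n + 1] (X.tau p)) (f^[n] (X.tau p)) := by
      intro n
      rw [Function.iterate_succ_apply']
      rcases hf (f^[n] (X.tau p)) with ⟨r, h⟩ | h
      · exact absurd h (hcon n r)
      · exact h
    have hback : ∀ m n, f^[m] (X.tau p) = f^[m + n] (X.tau p) →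
        X.tau p = f^[n] (X.tau p) := by
      intro m
      induction m with
      | zero => intro n h; simpa using h
      | succ m ih =>
        intro n h
        apply ih
        have h1 := hrel m
        have h2 := hrel (m + n)
        rw [h, show m + 1 + n = m + n + 1 by ring] at h1
        exact X.post_unique h1 h2
    obtain ⟨i, j, hij, he⟩ := Finite.exists_ne_map_eq_of_infinite (fun n => f^[n] (X.tau p))
    wlog hlt : i < j generalizing i j
    · exact this j i hij.symm he.symm (by omega)
    obtain ⟨n, rfl⟩ := Nat.exists_eq_add_of_lt hlt
    have h1 := hback i (n + 1) he
    have h2 := hrel n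
    rw [← h1] at h2
    exact X.not_tau_rel _ p h2
  obtain ⟨n, hn⟩ := key
  rcases X.exists_chain f hf n _ hn with ⟨r, hr⟩ | ⟨r, δ, h⟩
  · exact absurd hr (X.tau_ne_sig p r)
  · exact ⟨r, δ, (X.isDel_iff p r δ).2 h⟩

/-- The maximal antipath ending with `τ_p` is unique. -/
theorem isDel_unique (X : B.Blossoming) {p r r' : Fin X.d} {δ δ' : List B.E}
    (h : X.IsDel p r δ) (h' : X.IsDel p r' δ') : r = r' ∧ δ = δ' := by
  rw [isDel_iff] at h h'
  have main : ∀ (l l' : List B.E) (x : X.quiver.E),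
      (X.sig r :: (l.map X.old ++ [x])).IsChain X.quiver.rel →
      (X.sig r' :: (l'.map X.old ++ [x])).IsChain X.quiver.rel → r = r' ∧ l = l' := by
    intro l
    induction l using List.reverseRecOn with
    | nil =>
      intro l' x h h'
      have h1 : X.quiver.rel (X.sig r) x := by simpa using h
      rcases List.eq_nil_or_concat l' with rfl | ⟨l'', b, rfl⟩
      · have h2 : X.quiver.rel (X.sig r') x := by simpa using h'
        exact ⟨X.sig_inj (X.pre_unique h1 h2), rfl⟩
      · exfalso
        simp only [List.concat_eq_append, List.map_append, List.map_cons, List.map_nil,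
          List.append_assoc] at h'
        rw [← List.cons_append, List.isChain_append] at h'
        have h2 : X.quiver.rel (X.old b) x := by simpa using h'.2.1
        exact X.sig_ne_old _ _ (X.pre_unique h1 h2)
    | append_singleton l a ih =>
      intro l' x h h'
      simp only [List.map_append, List.map_cons, List.map_nil, List.append_assoc] at h
      have hs := h
      rw [← List.cons_append, List.isChain_append] at h
      have h1 : X.quiver.rel (X.old a) x := by simpa using h.2.1
      have hl : (X.sig r :: (l.map X.old ++ [X.old a])).IsChain X.quiver.rel := by
        have : X.sig r :: (l.map X.old ++ ([X.old a] ++ [x])) =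
          (X.sig r :: (l.map X.old ++ [X.old a])) ++ [x] := by simp
        rw [this, List.isChain_append] at hs
        exact hs.1
      rcases List.eq_nil_or_concat l' with rfl | ⟨l'', b, rfl⟩
      · exfalso
        have h2 : X.quiver.rel (X.sig r') x := by simpa using h'
        exact X.sig_ne_old _ _ (X.pre_unique h2 h1)
      · simp only [List.concat_eq_append, List.map_append, List.map_cons, List.map_nil,
          List.append_assoc] at h'
        have hs' := h'
        rw [← List.cons_append, List.isChain_append] at h'
        have h2 : X.quiver.rel (X.old b) x := by simpa using h'.2.1
        have hl' : (X.sig r' :: (l''.map X.old ++ [X.old b])).IsChain X.quiver.rel := by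
          have : X.sig r' :: (l''.map X.old ++ ([X.old b] ++ [x])) =
            (X.sig r' :: (l''.map X.old ++ [X.old b])) ++ [x] := by simp
          rw [this, List.isChain_append] at hs'
          exact hs'.1
        have hab : a = b := X.old_inj (X.pre_unique h1 h2)
        subst hab
        obtain ⟨e1, e2⟩ := ih l'' _ hl hl'
        exact ⟨e1, by rw [e2, List.concat_eq_append]⟩
  exact main δ δ' _ h h'

/-- A maximal antipath starting with `σ_r` ends with only one `τ_p`. -/
theorem isDel_injective (X : B.Blossoming) {p p' r : Fin X.d} {δ δ' : List B.E}
    (h : X.IsDel p r δ) (h' : X.IsDel p' r δ') : p = p' := by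
  rw [isDel_iff] at h h'
  have main : ∀ (l l' : List B.E) (x : X.quiver.E),
      (x :: (l.map X.old ++ [X.tau p])).IsChain X.quiver.rel →
      (x :: (l'.map X.old ++ [X.tau p'])).IsChain X.quiver.rel → p = p' := by
    intro l
    induction l with
    | nil =>
      intro l' x h h'
      have h1 : X.quiver.rel x (X.tau p) := by simpa using h
      rcases l' with _ | ⟨b, l'⟩
      · have h2 : X.quiver.rel x (X.tau p') := by simpa using h'
        exact X.tau_inj (X.post_unique h1 h2)
      · have h2 : X.quiver.rel x (X.old b) := (List.isChain_cons_cons.1 h').1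
        exact absurd (X.post_unique h1 h2) (X.tau_ne_old _ _)
    | cons a l ih =>
      intro l' x h h'
      have h1 := List.isChain_cons_cons.1 h
      rcases l' with _ | ⟨b, l'⟩
      · have h2 : X.quiver.rel x (X.tau p') := by simpa using h'
        exact absurd (X.post_unique h1.1 h2).symm (X.tau_ne_old _ _)
      · have h2 := List.isChain_cons_cons.1 h'
        have hab : a = b := X.old_inj (X.post_unique h1.1 h2.1)
        subst hab
        exact ih l' _ h1.2 h2.2
  exact main δ δ' _ h h'

/-- The index `Φ(p)` such that the maximal antipath ending at `t_p` starts at `s_{Φ(p)}`. -/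
noncomputable def phiFun (X : B.Blossoming) (p : Fin X.d) : Fin X.d :=
  (X.exists_isDel p).choose

/-- The (possibly empty) antipath `δ_p` obtained from the maximal antipath ending at `t_p` by
removing the two blossom arrows; the empty list stands for an idempotent `e_a`. -/
noncomputable def del (X : B.Blossoming) (p : Fin X.d) : List B.E :=
  (X.exists_isDel p).choose_spec.choose

theorem isDel_phiFun (X : B.Blossoming) (p : Fin X.d) : X.IsDel p (X.phiFun p) (X.del p) :=
  (X.exists_isDel p).choose_spec.choose_spec

theorem phiFun_injective (X : B.Blossoming) : Function.Injective X.phiFun := by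
  intro p p' h
  have h1 := X.isDel_phiFun p
  rw [h] at h1
  exact X.isDel_injective h1 (X.isDel_phiFun p')

/-- The permutation `Φ`. -/
noncomputable def Phi (X : B.Blossoming) : Equiv.Perm (Fin X.d) :=
  Equiv.ofBijective X.phiFun (Finite.injective_iff_bijective.1 X.phiFun_injective)

/-- `O` is (the set of indices `p` of the `δ_p` in) an AG-orbit. -/
def IsAGOrbit (X : B.Blossoming) (O : Finset (Fin X.d)) : Prop :=
  ∃ p, ∀ r, r ∈ O ↔ X.Phi.SameCycle p r

/-- The type `(q, l)` of an AG-orbit. -/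
noncomputable def type (X : B.Blossoming) (O : Finset (Fin X.d)) : ℕ × ℕ :=
  (O.card, ∑ p ∈ O, (X.del p).length)

/-- The Avella-Alaminos--Geiss invariant `φ_A(q, l)`, computed in the blossoming `X`. -/
noncomputable def phi (X : B.Blossoming) (q l : ℕ) : ℕ :=
  if q = 0 then Nat.card {c : Cycle B.E // B.IsAnticycle c ∧ c.length = l}
  else Nat.card {O : Finset (Fin X.d) // X.IsAGOrbit O ∧ X.type O = (q, l)}

/-- The `k`-fold gentle repetition, built from the blossoming `X`. The sheets are indexed by
`Fin k`. Its arrows are the copies `α^{[i]} = Sum.inl (i, α)` of the arrows of `B` and the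
connecting arrows `ϖ_p^{[i]} = Sum.inr (i, p)` from sheet `i` to sheet `i + 1`, which result from
welding `τ_p^{[i]}` and `σ_p^{[i+1]}` and take over their relations. -/
def rep (X : B.Blossoming) (k : ℕ) : BoundQuiver.{u, v} where
  V := Fin k × B.V
  E := (Fin k × B.E) ⊕ (Fin (k - 1) × Fin X.d)
  finV := inferInstance
  finE := inferInstance
  s := fun
    | Sum.inl (i, α) => (i, B.s α)
    | Sum.inr (i, p) => (⟨i, by omega⟩, X.tauS p)
  t := fun
    | Sum.inl (i, α) => (i, B.t α)
    | Sum.inr (i, p) => (⟨i + 1, by omega⟩, X.sigT p)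
  rel := fun
    | Sum.inl (i, α), Sum.inl (j, β) => i = j ∧ B.rel α β
    | Sum.inl (i, α), Sum.inr (j, p) => i.val = j.val ∧ X.quiver.rel (X.old α) (X.tau p)
    | Sum.inr (i, p), Sum.inl (j, β) => i.val + 1 = j.val ∧ X.quiver.rel (X.sig p) (X.old β)
    | Sum.inr (i, p), Sum.inr (j, r) => i.val + 1 = j.val ∧ X.quiver.rel (X.sig p) (X.tau r)
  rel_comp := by
    rintro (⟨i, α⟩ | ⟨i, p⟩) (⟨j, β⟩ | ⟨j, r⟩) ⟨hij, h⟩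
    · exact Prod.ext hij (B.rel_comp _ _ h)
    · have := X.quiver.rel_comp _ _ h
      simp only [BlossomData.quiver, BlossomData.old, BlossomData.tau, Sum.elim_inl, Sum.elim_inr,
        Sum.inl.injEq] at this
      exact Prod.ext (Fin.ext hij) this
    · have := X.quiver.rel_comp _ _ h
      simp only [BlossomData.quiver, BlossomData.old, BlossomData.sig, Sum.elim_inl, Sum.elim_inr,
        Sum.inl.injEq] at this
      exact Prod.ext (Fin.ext hij) this
    · have := X.quiver.rel_comp _ _ h
      simp only [BlossomData.quiver, BlossomData.tau, BlossomData.sig, Sum.elim_inl, Sum.elim_inr,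
        Sum.inl.injEq] at this
      exact Prod.ext (Fin.ext hij) this

/-- The vertex `a^{[i]}` of the `k`-fold gentle repetition. -/
def repVertex (X : B.Blossoming) (k : ℕ) (i : Fin k) (a : B.V) : (X.rep k).V := (i, a)

/-- The arrow `α^{[i]}` of the `k`-fold gentle repetition. -/
def repArrow (X : B.Blossoming) (k : ℕ) (i : Fin k) (α : B.E) : (X.rep k).E := Sum.inl (i, α)

end Blossoming

end BoundQuiver

/-- The type `(L/k, (L/q) l + (L/k) (k-1))`, `L = lcm(q, k)`; both divisions are exact if `q` and
`k` are positive. -/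
def repType (k q l : ℕ) : ℕ × ℕ :=
  (Nat.lcm q k / k, Nat.lcm q k / q * l + Nat.lcm q k / k * (k - 1))

/-- The set `S_{(k)}(n, m)`. -/
def repTypeSet (k n m : ℕ) : Set (ℕ × ℕ) :=
  {x | 0 < x.1 ∧ (n, m) = repType k x.1 x.2}

/-!
A locally gentle bound quiver is the same as a set of arrows with two injections into
`vertices × Bool`, its *slottings*: every vertex has two incoming and two outgoing slots, and a
composable pair of arrows is a relation exactly if the slots they occupy at the vertex between them
have the same index. Blossom arrows are then the free slots. As there are equally many free incoming
and free outgoing slots, and as each maximal path starting in a free incoming slot ends in a free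
outgoing slot, a blossoming exists (`IsLocallyGentle.nonempty_blossoming`).

The `k`-fold repetition inherits a slotting from the blossoming `X` that it is built from
(`isSlotting_rep`), so it is locally gentle. Its arrows never lead to a lower sheet, so a closed
path stays in one sheet (`exists_cycle_map_repArrow`); this gives the description of the anticycles
and the absence of oriented cycles. The repetition is connected because there are connecting arrows:
a gentle bound quiver without blossoms would have an oriented cycle (`d_pos`).

Let `Y` be any blossoming of the repetition. A slotting of `Y` can be chosen which agrees with the
inherited one on the arrows of the repetition (`IsSlotting.exists_extend`). The slots left for the
arrows `σ` of `Y` are those of the `σ_p` in the lowest sheet, and the slots left for the arrows `τ`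
of `Y` are those of the `τ_p` in the highest sheet, which matches the labels of `Y` with those of
`X`. Every sheet of `Y` now looks like `X`, where the arrow entering the sheet in place of `σ_p` is
the one which leaves the preceding sheet in place of `τ_p`. Hence `k` chains of `X` from
`σ_{ψ r}` to `τ_r`, for `r = p, ψ p, …, ψ^{k-1} p`, join to one chain of `Y`
(`Alignment.exists_chain_lift`). For the maximal paths, where `ψ` is the identity, this shows that
`σ` and `τ` are matched by the same bijection `e` of the labels; for the maximal antipaths, where
`ψ` is `Φ`, it shows that `Φ` for `Y` is `Φ ^ k` for `X` and that
`δ_{e p}` has length `∑_{j < k} length (δ_{Φ^j p}) + (k - 1)` (`exists_label_equiv`).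

What remains is the way in which an orbit of a permutation with `q` elements splits under its `k`-th
power: into `gcd q k` orbits with `q / gcd q k` elements each (`IsPermOrbit.card_orbits_pow`,
`IsPermOrbit.sum_pow`). Counting the orbits for `Y` by the orbits for `X` that contain them gives
the formula for the invariants (`phi_rep_of_orbits`).
-/

/-! ### Slottings -/

namespace BoundQuiver

/-- A slotting of a bound quiver. Every vertex `a` is given two incoming slots and two outgoing
slots, both indexed by `Bool`; an arrow `x` occupies the incoming slot `f x` of its target and the
outgoing slot `g x` of its source, no slot being used twice, and a composable pair `x, y` is a
relation exactly if the slots that they occupy at the vertex between them have the same index. -/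
structure IsSlotting (B : BoundQuiver.{u, v}) (f g : B.E → Bool) : Prop where
  inj_t : ∀ ⦃x y⦄, B.t x = B.t y → f x = f y → x = y
  inj_s : ∀ ⦃x y⦄, B.s x = B.s y → g x = g y → x = y
  rel_iff : ∀ ⦃x y⦄, B.t x = B.s y → (B.rel x y ↔ f x = g y)

namespace IsSlotting

variable {B : BoundQuiver.{u, v}} {f g : B.E → Bool}

theorem rel_iff' (h : B.IsSlotting f g) {x y : B.E} :
    B.rel x y ↔ B.t x = B.s y ∧ f x = g y :=
  ⟨fun hr => ⟨B.rel_comp _ _ hr, (h.rel_iff (B.rel_comp _ _ hr)).1 hr⟩,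
    fun hr => (h.rel_iff hr.1).2 hr.2⟩

theorem nonzero_iff (h : B.IsSlotting f g) {x y : B.E} :
    B.Nonzero x y ↔ B.t x = B.s y ∧ f x = !(g y) := by
  unfold Nonzero
  refine and_congr_right fun hxy => ?_
  rw [h.rel_iff hxy, Bool.eq_not]

theorem isLocallyGentle (h : B.IsSlotting f g) : B.IsLocallyGentle where
  inDeg_le a := by
    have := Nat.card_le_card_of_injective (fun x : {x : B.E // B.t x = a} => f x.1)
      (fun x y hxy => Subtype.ext (h.inj_t (x.2.trans y.2.symm) hxy))
    simpa [inDeg] using this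
  outDeg_le a := by
    have := Nat.card_le_card_of_injective (fun x : {x : B.E // B.s x = a} => g x.1)
      (fun x y hxy => Subtype.ext (h.inj_s (x.2.trans y.2.symm) hxy))
    simpa [outDeg] using this
  pre_rel x y hy z hz :=
    h.inj_t (hy.1.trans hz.1.symm) (((h.rel_iff hy.1).1 hy.2).trans ((h.rel_iff hz.1).1 hz.2).symm)
  pre_nonzero x y hy z hz :=
    h.inj_t (hy.1.trans hz.1.symm) ((h.nonzero_iff.1 hy).2.trans (h.nonzero_iff.1 hz).2.symm)
  post_rel x y hy z hz :=
    h.inj_s (hy.1.symm.trans hz.1)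
      (((h.rel_iff hy.1).1 hy.2).symm.trans ((h.rel_iff hz.1).1 hz.2))
  post_nonzero x y hy z hz :=
    h.inj_s (hy.1.symm.trans hz.1)
      (Bool.not_inj ((h.nonzero_iff.1 hy).2.symm.trans (h.nonzero_iff.1 hz).2))

theorem exists_t_eq (h : B.IsSlotting f g) {a : B.V} (ha : B.inDeg a = 2) (b : Bool) :
    ∃ x, B.t x = a ∧ f x = b := by
  have hi : Function.Injective (fun x : {x : B.E // B.t x = a} => f x.1) :=
    fun x y hxy => Subtype.ext (h.inj_t (x.2.trans y.2.symm) hxy)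
  obtain ⟨x, hx⟩ := ((Nat.bijective_iff_injective_and_card _).2
    ⟨hi, by rw [Nat.card_eq_fintype_card (α := Bool), Fintype.card_bool]; exact ha⟩).2 b
  exact ⟨x.1, x.2, hx⟩

theorem exists_s_eq (h : B.IsSlotting f g) {a : B.V} (ha : B.outDeg a = 2) (b : Bool) :
    ∃ x, B.s x = a ∧ g x = b := by
  have hi : Function.Injective (fun x : {x : B.E // B.s x = a} => g x.1) :=
    fun x y hxy => Subtype.ext (h.inj_s (x.2.trans y.2.symm) hxy)
  obtain ⟨x, hx⟩ := ((Nat.bijective_iff_injective_and_card _).2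
    ⟨hi, by rw [Nat.card_eq_fintype_card (α := Bool), Fintype.card_bool]; exact ha⟩).2 b
  exact ⟨x.1, x.2, hx⟩

theorem inDeg_eq_two (h : B.IsSlotting f g) {a : B.V} (ha : ∀ b, ∃ x, B.t x = a ∧ f x = b) :
    B.inDeg a = 2 := by
  have hb : Function.Bijective (fun x : {x : B.E // B.t x = a} => f x.1) :=
    ⟨fun x y hxy => Subtype.ext (h.inj_t (x.2.trans y.2.symm) hxy),
      fun b => let ⟨x, hx, hf⟩ := ha b; ⟨⟨x, hx⟩, hf⟩⟩
  rw [inDeg, Nat.card_congr (Equiv.ofBijective _ hb), Nat.card_eq_fintype_card, Fintype.card_bool]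

theorem outDeg_eq_two (h : B.IsSlotting f g) {a : B.V} (ha : ∀ b, ∃ x, B.s x = a ∧ g x = b) :
    B.outDeg a = 2 := by
  have hb : Function.Bijective (fun x : {x : B.E // B.s x = a} => g x.1) :=
    ⟨fun x y hxy => Subtype.ext (h.inj_s (x.2.trans y.2.symm) hxy),
      fun b => let ⟨x, hx, hf⟩ := ha b; ⟨⟨x, hx⟩, hf⟩⟩
  rw [outDeg, Nat.card_congr (Equiv.ofBijective _ hb), Nat.card_eq_fintype_card, Fintype.card_bool]

/-- Exchanging the two indices at some of the vertices, a slotting can be made to agree with a given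
one on a set `U` of arrows. -/
theorem exists_extend (h : B.IsSlotting f g) (U : Set B.E) {f₀ g₀ : B.E → Bool}
    (ht : ∀ x ∈ U, ∀ y ∈ U, B.t x = B.t y → f₀ x = f₀ y → x = y)
    (hs : ∀ x ∈ U, ∀ y ∈ U, B.s x = B.s y → g₀ x = g₀ y → x = y)
    (hr : ∀ x ∈ U, ∀ y ∈ U, B.t x = B.s y → (B.rel x y ↔ f₀ x = g₀ y)) :
    ∃ f' g', B.IsSlotting f' g' ∧ (∀ x ∈ U, f' x = f₀ x) ∧ ∀ x ∈ U, g' x = g₀ x := by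
  have key : ∀ a, ∃ b : Bool, (∀ x ∈ U, B.t x = a → (f x ^^ b) = f₀ x) ∧
      ∀ y ∈ U, B.s y = a → (g y ^^ b) = g₀ y := by
    intro a
    by_cases hin : ∃ x ∈ U, B.t x = a
    · obtain ⟨x, hxU, hx⟩ := hin
      refine ⟨f x ^^ f₀ x, fun x' hx'U hx' => ?_, fun y hyU hy => ?_⟩
      · by_cases hxx : x' = x
        · subst hxx; simp
        · have h1 := fun e => hxx (h.inj_t (hx'.trans hx.symm) e)
          have h2 := fun e => hxx (ht _ hx'U _ hxU (hx'.trans hx.symm) e)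
          revert h1 h2
          cases f x <;> cases f x' <;> cases f₀ x <;> cases f₀ x' <;> simp
      · have h1 := (h.rel_iff (hx.trans hy.symm)).symm.trans (hr _ hxU _ hyU (hx.trans hy.symm))
        revert h1
        cases f x <;> cases g y <;> cases f₀ x <;> cases g₀ y <;> simp
    · by_cases hout : ∃ y ∈ U, B.s y = a
      · obtain ⟨y, hyU, hy⟩ := hout
        refine ⟨g y ^^ g₀ y, fun x hxU hx => absurd ⟨x, hxU, hx⟩ hin, fun y' hy'U hy' => ?_⟩
        by_cases hyy : y' = y
        · subst hyy; simp
        · have h1 := fun e => hyy (h.inj_s (hy'.trans hy.symm) e)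
          have h2 := fun e => hyy (hs _ hy'U _ hyU (hy'.trans hy.symm) e)
          revert h1 h2
          cases g y <;> cases g y' <;> cases g₀ y <;> cases g₀ y' <;> simp
      · exact ⟨true, fun x hxU hx => absurd ⟨x, hxU, hx⟩ hin,
          fun y hyU hy => absurd ⟨y, hyU, hy⟩ hout⟩
  choose c hc using key
  refine ⟨fun x => f x ^^ c (B.t x), fun y => g y ^^ c (B.s y), ⟨?_, ?_, ?_⟩,
    fun x hx => (hc _).1 x hx rfl, fun x hx => (hc _).2 x hx rfl⟩
  · intro x y hxy he
    refine h.inj_t hxy ?_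
    simpa [hxy] using he
  · intro x y hxy he
    refine h.inj_s hxy ?_
    simpa [hxy] using he
  · intro x y hxy
    rw [h.rel_iff hxy]
    simp [hxy]

end IsSlotting

/-- In a set of at most two elements, those different from a given one coincide. -/
theorem eq_of_ne_of_card_le_two {α : Type*} [Finite α] {p : α → Prop}
    (hp : Nat.card {a // p a} ≤ 2) {x y z : α} (hx : p x) (hy : p y) (hz : p z) (hyx : y ≠ x)
    (hzx : z ≠ x) : y = z := by
  by_contra hyz
  have hinj : Function.Injective
      (![⟨x, hx⟩, ⟨y, hy⟩, ⟨z, hz⟩] : Fin 3 → {a // p a}) := by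
    intro i j hij
    fin_cases i <;> fin_cases j <;> simp_all
  have := Nat.card_le_card_of_injective _ hinj
  rw [Nat.card_eq_fintype_card, Fintype.card_fin] at this
  omega

theorem IsLocallyGentle.exists_isSlotting {B : BoundQuiver.{u, v}} (h : B.IsLocallyGentle) :
    ∃ f g, B.IsSlotting f g := by
  classical
  have key : ∀ a, ∃ f g : B.E → Bool,
      (∀ x y, B.t x = a → B.t y = a → f x = f y → x = y) ∧
      (∀ x y, B.s x = a → B.s y = a → g x = g y → x = y) ∧
      ∀ x y, B.t x = a → B.s y = a → (B.rel x y ↔ f x = g y) := by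
    intro a
    have two_in : ∀ x y z, B.t x = a → B.t y = a → B.t z = a → y ≠ x → z ≠ x → y = z :=
      fun x y z => eq_of_ne_of_card_le_two (h.inDeg_le a)
    have two_out : ∀ x y z, B.s x = a → B.s y = a → B.s z = a → y ≠ x → z ≠ x → y = z :=
      fun x y z => eq_of_ne_of_card_le_two (h.outDeg_le a)
    by_cases hin : ∃ x, B.t x = a
    · -- an incoming arrow `x` fixes all slots: it takes `true`, and so do its successors in `I`
      obtain ⟨x, hx⟩ := hin
      refine ⟨fun x' => decide (x' = x), fun y => decide (B.rel x y), ?_, ?_, ?_⟩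
      · intro y z hy hz he
        by_cases h1 : y = x <;> by_cases h2 : z = x
        · rw [h1, h2]
        · simp [h1, h2] at he
        · simp [h1, h2] at he
        · exact two_in x y z hx hy hz h1 h2
      · intro y z hy hz he
        by_cases h1 : B.rel x y <;> by_cases h2 : B.rel x z
        · exact h.post_rel x ⟨hx.trans hy.symm, h1⟩ ⟨hx.trans hz.symm, h2⟩
        · simp [h1, h2] at he
        · simp [h1, h2] at he
        · exact h.post_nonzero x ⟨hx.trans hy.symm, h1⟩ ⟨hx.trans hz.symm, h2⟩
      · intro x' y hx' hy
        by_cases h1 : x' = x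
        · subst h1; simp
        · simp only [h1, decide_false, Bool.false_eq, decide_eq_false_iff_not]
          constructor
          · exact fun h2 h3 => h1 (h.pre_rel y ⟨hx'.trans hy.symm, h2⟩ ⟨hx.trans hy.symm, h3⟩)
          · exact fun h3 => by_contra fun h2 =>
              h1 (h.pre_nonzero y ⟨hx'.trans hy.symm, h2⟩ ⟨hx.trans hy.symm, h3⟩)
    · by_cases hout : ∃ y, B.s y = a
      · obtain ⟨y, hy⟩ := hout
        refine ⟨fun _ => true, fun y' => decide (y' = y), fun x _ hx => absurd ⟨x, hx⟩ hin, ?_,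
          fun x _ hx => absurd ⟨x, hx⟩ hin⟩
        intro w z hw hz he
        by_cases h1 : w = y <;> by_cases h2 : z = y
        · rw [h1, h2]
        · simp [h1, h2] at he
        · simp [h1, h2] at he
        · exact two_out y w z hy hw hz h1 h2
      · exact ⟨fun _ => true, fun _ => true, fun x _ hx => absurd ⟨x, hx⟩ hin,
          fun x _ hx => absurd ⟨x, hx⟩ hout, fun x _ hx => absurd ⟨x, hx⟩ hin⟩
  choose F G hF hG hR using key
  refine ⟨fun x => F (B.t x) x, fun y => G (B.s y) y, ?_, ?_, ?_⟩
  · intro x y hxy he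
    exact hF _ x y rfl hxy.symm (by simpa [hxy] using he)
  · intro x y hxy he
    exact hG _ x y rfl hxy.symm (by simpa [hxy] using he)
  · intro x y hxy
    rw [hR _ x y rfl hxy.symm, hxy]

end BoundQuiver

/-! ### Following a relation -/

/-- On a finite type, following an injective relation from an element without predecessor ends at
an element without successor. -/
theorem exists_isChain_terminal {Z : Type*} [Finite Z] {R : Z → Z → Prop}
    (hR : ∀ x y z, R x z → R y z → x = y) {a : Z} (ha : ∀ x, ¬ R x a) :
    ∃ (l : List Z) (b : Z), (a :: l).IsChain R ∧ (a :: l).getLast (by simp) = b ∧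
      ∀ y, ¬ R b y := by
  obtain ⟨b, hab, hb⟩ : ∃ b, Relation.ReflTransGen R a b ∧ ∀ y, ¬ R b y := by
    by_contra hcon
    push Not at hcon
    have hsucc : ∀ x, ∃ y, Relation.ReflTransGen R a x → R x y := by
      intro x
      by_cases hx : Relation.ReflTransGen R a x
      · obtain ⟨y, hy⟩ := hcon x hx
        exact ⟨y, fun _ => hy⟩
      · exact ⟨x, fun h => absurd h hx⟩
    choose f hf using hsucc
    have hreach : ∀ n, Relation.ReflTransGen R a (f^[n] a) := by
      intro n
      induction n with
      | zero => exact .refl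
      | succ n ih => rw [Function.iterate_succ_apply']; exact ih.tail (hf _ ih)
    have hrel : ∀ n, R (f^[n] a) (f^[n + 1] a) := fun n => by
      rw [Function.iterate_succ_apply']; exact hf _ (hreach n)
    have hback : ∀ m n, f^[m] a = f^[m + n] a → a = f^[n] a := by
      intro m
      induction m with
      | zero => intro n h; simpa using h
      | succ m ih =>
        intro n h
        have h2 := hrel (m + n)
        rw [show m + n + 1 = m + 1 + n by ring, ← h] at h2
        exact ih n (hR _ _ _ (hrel m) h2)
    obtain ⟨i, j, hij, he⟩ := Finite.exists_ne_map_eq_of_infinite (fun n => f^[n] a)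
    wlog hlt : i < j generalizing i j
    · exact this j i hij.symm he.symm (by omega)
    obtain ⟨n, rfl⟩ := Nat.exists_eq_add_of_lt hlt
    have h1 := hback i (n + 1) he
    have h2 := hrel n
    rw [← h1] at h2
    exact ha _ h2
  obtain ⟨l, hl, hlast⟩ := List.exists_isChain_cons_of_relationReflTransGen hab
  exact ⟨l, b, hl, hlast, hb⟩

/-- Two chains of a functional relation with the same start, both ending at elements without
successor, have the same end. -/
theorem isChain_end_unique {Z : Type*} {R : Z → Z → Prop}
    (hR : ∀ x y z, R x y → R x z → y = z) {b b' : Z} (hb : ∀ y, ¬ R b y) (hb' : ∀ y, ¬ R b' y) :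
    ∀ (l l' : List Z) (x : Z), (x :: (l ++ [b])).IsChain R → (x :: (l' ++ [b'])).IsChain R →
      b = b' := by
  intro l
  induction l with
  | nil =>
    intro l' x h h'
    have h1 : R x b := by simpa using h
    rcases l' with _ | ⟨c, l'⟩
    · exact hR _ _ _ h1 (by simpa using h')
    · have h2 := List.isChain_cons_cons.1 h'
      have := hR _ _ _ h1 h2.1
      subst this
      rcases l' with _ | ⟨c, l'⟩
      · exact absurd (by simpa using h2.2) (hb b')
      · exact absurd (List.isChain_cons_cons.1 h2.2).1 (hb c)
  | cons a l ih =>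
    intro l' x h h'
    have h1 := List.isChain_cons_cons.1 h
    rcases l' with _ | ⟨c, l'⟩
    · have h2 : R x b' := by simpa using h'
      have := hR _ _ _ h2 h1.1
      subst this
      rcases l with _ | ⟨c, l⟩
      · exact absurd (by simpa using h1.2) (hb' b)
      · exact absurd (List.isChain_cons_cons.1 h1.2).1 (hb' c)
    · have h2 := List.isChain_cons_cons.1 h'
      have := hR _ _ _ h1.1 h2.1
      subst this
      exact ih l' _ h1.2 h2.2

/-! ### Existence of blossomings -/

namespace BoundQuiver

namespace BlossomData

variable {B : BoundQuiver.{u, v}} (X : BlossomData B)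

theorem arrow_cases (x : X.quiver.E) :
    (∃ a, x = X.old a) ∨ (∃ p, x = X.sig p) ∨ ∃ p, x = X.tau p := by
  rcases x with a | p | p
  · exact Or.inl ⟨a, rfl⟩
  · exact Or.inr (Or.inl ⟨p, rfl⟩)
  · exact Or.inr (Or.inr ⟨p, rfl⟩)

@[simp] theorem t_old (a : B.E) : X.quiver.t (X.old a) = Sum.inl (B.t a) := rfl
@[simp] theorem s_old (a : B.E) : X.quiver.s (X.old a) = Sum.inl (B.s a) := rfl
@[simp] theorem t_sig (p : Fin X.d) : X.quiver.t (X.sig p) = Sum.inl (X.sigT p) := rfl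
@[simp] theorem s_tau (p : Fin X.d) : X.quiver.s (X.tau p) = Sum.inl (X.tauS p) := rfl

theorem t_ne_s_sig (x : X.quiver.E) (p : Fin X.d) : X.quiver.t x ≠ X.quiver.s (X.sig p) :=
  match x with
  | Sum.inl _ => Sum.inl_ne_inr
  | Sum.inr (Sum.inl _) => Sum.inl_ne_inr
  | Sum.inr (Sum.inr _) => fun h => Sum.inr_ne_inl (Sum.inr.inj h)

theorem t_tau_ne_s (x : X.quiver.E) (p : Fin X.d) : X.quiver.t (X.tau p) ≠ X.quiver.s x :=
  match x with
  | Sum.inl _ => Sum.inr_ne_inl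
  | Sum.inr (Sum.inl _) => fun h => Sum.inr_ne_inl (Sum.inr.inj h)
  | Sum.inr (Sum.inr _) => Sum.inr_ne_inl

/-- The inner arrows of a composable sequence ending with some `τ_q` are old. -/
theorem exists_map_old_of_isChain {R : X.quiver.E → X.quiver.E → Prop}
    (hR : ∀ x y, R x y → X.quiver.t x = X.quiver.s y) (q : Fin X.d) :
    ∀ (l : List X.quiver.E) (x : X.quiver.E), (x :: (l ++ [X.tau q])).IsChain R →
      ∃ w : List B.E, l = w.map X.old := by
  intro l
  induction l with
  | nil => exact fun x _ => ⟨[], rfl⟩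
  | cons y l ih =>
    intro x h
    have h1 := List.isChain_cons_cons.1 h
    obtain ⟨w, rfl⟩ := ih y h1.2
    obtain ⟨a, rfl⟩ | ⟨r, rfl⟩ | ⟨r, rfl⟩ := X.arrow_cases y
    · exact ⟨a :: w, rfl⟩
    · exact absurd (hR _ _ h1.1) (X.t_ne_s_sig x r)
    · exfalso
      obtain ⟨z, m, hz⟩ : ∃ z m, w.map X.old ++ [X.tau q] = z :: m :=
        List.exists_cons_of_ne_nil (by simp)
      have h2 : (X.tau r :: (w.map X.old ++ [X.tau q])).IsChain R := h1.2
      rw [hz] at h2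
      exact X.t_tau_ne_s z r (hR _ _ (List.isChain_cons_cons.1 h2).1)

theorem isMaximalPath_iff (p q : Fin X.d) (w : List B.E) :
    X.quiver.IsMaximalPath (X.sig p :: (w.map X.old ++ [X.tau q])) ↔
      (X.sig p :: (w.map X.old ++ [X.tau q])).IsChain X.quiver.Nonzero := by
  constructor
  · exact fun h => h.1.2
  · intro h
    refine ⟨⟨by simp, h⟩, fun α => ⟨fun hα => ?_, fun hα => ?_⟩⟩
    · exact X.t_ne_s_sig α p (List.isChain_cons_cons.1 hα.2).1.1
    · have h1 := hα.2
      rw [← List.cons_append, List.append_assoc, List.isChain_append] at h1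
      exact X.t_tau_ne_s α q (List.isChain_cons_cons.1 h1.2.1).1.1

variable (hout : ∀ a : B.V, X.quiver.outDeg (Sum.inl a) = 2) (hX : X.quiver.IsLocallyGentle)

include hout hX in
/-- Every maximal path starting with `σ_p` ends with some `τ_q`. -/
theorem exists_nonzero_chain (p : Fin X.d) : ∃ (q : Fin X.d) (w : List B.E),
    (X.sig p :: (w.map X.old ++ [X.tau q])).IsChain X.quiver.Nonzero := by
  obtain ⟨f, g, h⟩ := hX.exists_isSlotting
  obtain ⟨l, b, hl, hlast, hb⟩ := exists_isChain_terminal (R := X.quiver.Nonzero)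
    (fun x y z hx hy => hX.pre_nonzero z hx hy) (fun x hx => X.t_ne_s_sig x p hx.1)
  have hterm : ∀ v, X.quiver.t b ≠ Sum.inl v := by
    intro v hv
    obtain ⟨y, hy, hgy⟩ := h.exists_s_eq (hout v) (!(f b))
    exact hb y (h.nonzero_iff.2 ⟨hv.trans hy.symm, by simp [hgy]⟩)
  obtain ⟨a, rfl⟩ | ⟨q, rfl⟩ | ⟨q, rfl⟩ := X.arrow_cases b
  · exact absurd rfl (hterm _)
  · exact absurd rfl (hterm _)
  rcases List.eq_nil_or_concat l with rfl | ⟨l, c, rfl⟩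
  · exact absurd hlast (fun h => nomatch h)
  · rw [List.concat_eq_append] at hl
    obtain rfl : c = X.tau q := by simpa using hlast
    obtain ⟨w, rfl⟩ := X.exists_map_old_of_isChain (fun x y h => h.1) q l _ hl
    exact ⟨q, w, hl⟩

include hX in
theorem nonzero_chain_start_unique {p p' q : Fin X.d} {w w' : List B.E}
    (h : (X.sig p :: (w.map X.old ++ [X.tau q])).IsChain X.quiver.Nonzero)
    (h' : (X.sig p' :: (w'.map X.old ++ [X.tau q])).IsChain X.quiver.Nonzero) : p = p' := by
  rw [← List.isChain_reverse] at h h'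
  simp only [List.reverse_cons, List.reverse_append, List.reverse_nil, List.nil_append,
    List.cons_append] at h h'
  have := isChain_end_unique (R := fun a b => X.quiver.Nonzero b a)
    (fun x y z hy hz => hX.pre_nonzero x hy hz) (fun y hy => X.t_ne_s_sig y p hy.1)
    (fun y hy => X.t_ne_s_sig y p' hy.1) _ _ _ h h'
  exact Sum.inl.inj (Sum.inr.inj this)

include hX in
theorem nonzero_chain_end_unique {p q q' : Fin X.d} {w w' : List B.E}
    (h : (X.sig p :: (w.map X.old ++ [X.tau q])).IsChain X.quiver.Nonzero)
    (h' : (X.sig p :: (w'.map X.old ++ [X.tau q'])).IsChain X.quiver.Nonzero) : q = q' := by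
  have := isChain_end_unique (R := X.quiver.Nonzero)
    (fun x y z hy hz => hX.post_nonzero x hy hz) (fun y hy => X.t_tau_ne_s y q hy.1)
    (fun y hy => X.t_tau_ne_s y q' hy.1) _ _ _ h h'
  exact Sum.inr.inj (Sum.inr.inj this)

end BlossomData

section Slots

variable {B : BoundQuiver.{u, v}} (f g : B.E → Bool)

/-- The incoming slots which are not occupied by an arrow. -/
abbrev FreeIn : Type u := {z : B.V × Bool // z ∉ Set.range fun x => (B.t x, f x)}

/-- The outgoing slots which are not occupied by an arrow. -/
abbrev FreeOut : Type u := {z : B.V × Bool // z ∉ Set.range fun x => (B.s x, g x)}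

variable {f g}

theorem IsSlotting.card_freeIn_eq (h : B.IsSlotting f g) :
    Nat.card (FreeIn f) = Nat.card (FreeOut g) := by
  have h1 : Function.Injective fun x => (B.t x, f x) :=
    fun x y hxy => h.inj_t (Prod.ext_iff.1 hxy).1 (Prod.ext_iff.1 hxy).2
  have h2 : Function.Injective fun x => (B.s x, g x) :=
    fun x y hxy => h.inj_s (Prod.ext_iff.1 hxy).1 (Prod.ext_iff.1 hxy).2
  have e1 := Set.ncard_add_ncard_compl (Set.range fun x => (B.t x, f x))
  have e2 := Set.ncard_add_ncard_compl (Set.range fun x => (B.s x, g x))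
  rw [Set.ncard_range_of_injective h1] at e1
  rw [Set.ncard_range_of_injective h2] at e2
  change (Set.range fun x => (B.t x, f x))ᶜ.ncard = (Set.range fun x => (B.s x, g x))ᶜ.ncard
  omega

variable {d : ℕ} (σ : Fin d ≃ FreeIn f) (τ : Fin d ≃ FreeOut g)

/-- The incoming slots of the old arrows and of the blossom arrows `σ_p`, which fill the free slots;
the value at `τ_p` is immaterial. -/
def slotIn : B.E ⊕ (Fin d ⊕ Fin d) → Bool :=
  Sum.elim f (Sum.elim (fun p => (σ p).1.2) (fun _ => true))

/-- The outgoing slots of the old arrows and of the blossom arrows `τ_p`, which fill the free slots;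
the value at `σ_p` is immaterial. -/
def slotOut : B.E ⊕ (Fin d ⊕ Fin d) → Bool :=
  Sum.elim g (Sum.elim (fun _ => true) (fun p => (τ p).1.2))

/-- The bound quiver `B` with one blossom arrow added in each free slot. -/
def fill : BlossomData B where
  d := d
  sigT p := (σ p).1.1
  tauS p := (τ p).1.1
  rel x y := Sum.elim (fun α => Sum.inl (B.t α))
        (Sum.elim (fun p => Sum.inl (σ p).1.1) (fun p => Sum.inr (Sum.inr p))) x =
      (Sum.elim (fun α => Sum.inl (B.s α))
        (Sum.elim (fun p => Sum.inr (Sum.inl p)) (fun p => Sum.inl (τ p).1.1)) y :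
          B.V ⊕ (Fin d ⊕ Fin d)) ∧ slotIn σ x = slotOut τ y
  rel_comp _ _ h := h.1

theorem isSlotting_fill (h : B.IsSlotting f g) :
    (fill σ τ).quiver.IsSlotting (slotIn σ) (slotOut τ) where
  inj_t
    | Sum.inl _, Sum.inl _, hxy, he => congrArg Sum.inl (h.inj_t (Sum.inl.inj hxy) he)
    | Sum.inl x, Sum.inr (Sum.inl q), hxy, he =>
        absurd ⟨x, Prod.ext (Sum.inl.inj hxy) he⟩ (σ q).2
    | Sum.inl _, Sum.inr (Sum.inr _), hxy, _ => nomatch hxy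
    | Sum.inr (Sum.inl p), Sum.inl y, hxy, he =>
        absurd ⟨y, Prod.ext (Sum.inl.inj hxy).symm he.symm⟩ (σ p).2
    | Sum.inr (Sum.inl _), Sum.inr (Sum.inl _), hxy, he =>
        congrArg (fun p => Sum.inr (Sum.inl p))
          (σ.injective (Subtype.ext (Prod.ext (Sum.inl.inj hxy) he)))
    | Sum.inr (Sum.inl _), Sum.inr (Sum.inr _), hxy, _ => nomatch hxy
    | Sum.inr (Sum.inr _), Sum.inl _, hxy, _ => nomatch hxy
    | Sum.inr (Sum.inr _), Sum.inr (Sum.inl _), hxy, _ => nomatch hxy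
    | Sum.inr (Sum.inr _), Sum.inr (Sum.inr _), hxy, _ => congrArg Sum.inr (Sum.inr.inj hxy)
  inj_s
    | Sum.inl _, Sum.inl _, hxy, he => congrArg Sum.inl (h.inj_s (Sum.inl.inj hxy) he)
    | Sum.inl x, Sum.inr (Sum.inr q), hxy, he =>
        absurd ⟨x, Prod.ext (Sum.inl.inj hxy) he⟩ (τ q).2
    | Sum.inl _, Sum.inr (Sum.inl _), hxy, _ => nomatch hxy
    | Sum.inr (Sum.inr p), Sum.inl y, hxy, he =>
        absurd ⟨y, Prod.ext (Sum.inl.inj hxy).symm he.symm⟩ (τ p).2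
    | Sum.inr (Sum.inr _), Sum.inr (Sum.inr _), hxy, he =>
        congrArg (fun p => Sum.inr (Sum.inr p))
          (τ.injective (Subtype.ext (Prod.ext (Sum.inl.inj hxy) he)))
    | Sum.inr (Sum.inr _), Sum.inr (Sum.inl _), hxy, _ => nomatch hxy
    | Sum.inr (Sum.inl _), Sum.inl _, hxy, _ => nomatch hxy
    | Sum.inr (Sum.inl _), Sum.inr (Sum.inr _), hxy, _ => nomatch hxy
    | Sum.inr (Sum.inl _), Sum.inr (Sum.inl _), hxy, _ => congrArg Sum.inr (Sum.inr.inj hxy)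
  rel_iff _ _ hxy := ⟨fun hr => hr.2, fun he => ⟨hxy, he⟩⟩

theorem fill_inDeg (h : B.IsSlotting f g) (a : B.V) :
    (fill σ τ).quiver.inDeg (Sum.inl a) = 2 := by
  refine (isSlotting_fill σ τ h).inDeg_eq_two fun b => ?_
  by_cases hab : (a, b) ∈ Set.range fun x => (B.t x, f x)
  · obtain ⟨x, hx⟩ := hab
    exact ⟨Sum.inl x, congrArg Sum.inl (Prod.ext_iff.1 hx).1, (Prod.ext_iff.1 hx).2⟩
  · have he := congrArg Subtype.val (σ.apply_symm_apply ⟨(a, b), hab⟩)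
    exact ⟨Sum.inr (Sum.inl (σ.symm ⟨(a, b), hab⟩)), congrArg Sum.inl (Prod.ext_iff.1 he).1,
      (Prod.ext_iff.1 he).2⟩

theorem fill_outDeg (h : B.IsSlotting f g) (a : B.V) :
    (fill σ τ).quiver.outDeg (Sum.inl a) = 2 := by
  refine (isSlotting_fill σ τ h).outDeg_eq_two fun b => ?_
  by_cases hab : (a, b) ∈ Set.range fun x => (B.s x, g x)
  · obtain ⟨x, hx⟩ := hab
    exact ⟨Sum.inl x, congrArg Sum.inl (Prod.ext_iff.1 hx).1, (Prod.ext_iff.1 hx).2⟩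
  · have he := congrArg Subtype.val (τ.apply_symm_apply ⟨(a, b), hab⟩)
    exact ⟨Sum.inr (Sum.inr (τ.symm ⟨(a, b), hab⟩)), congrArg Sum.inl (Prod.ext_iff.1 he).1,
      (Prod.ext_iff.1 he).2⟩

end Slots

theorem IsLocallyGentle.nonempty_blossoming {B : BoundQuiver.{u, v}} (hB : B.IsLocallyGentle) :
    Nonempty B.Blossoming := by
  obtain ⟨f, g, h⟩ := hB.exists_isSlotting
  let σ : Fin (Nat.card (FreeIn f)) ≃ FreeIn f := (Finite.equivFin _).symm
  let τ : Fin (Nat.card (FreeIn f)) ≃ FreeOut g :=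
    (finCongr h.card_freeIn_eq).trans (Finite.equivFin _).symm
  have hg := (isSlotting_fill σ τ h).isLocallyGentle
  -- the maximal paths pair the sources with the sinks; `τ` is relabelled accordingly
  choose π w hw using (fill σ τ).exists_nonzero_chain (fill_outDeg σ τ h) hg
  have hπ : Function.Injective π := by
    intro p q hpq
    have h1 := hw q
    rw [← hpq] at h1
    exact (fill σ τ).nonzero_chain_start_unique hg (hw p) h1
  let e : Fin (Nat.card (FreeIn f)) ≃ Fin (Nat.card (FreeIn f)) :=
    Equiv.ofBijective π (Finite.injective_iff_bijective.1 hπ)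
  have h' := isSlotting_fill σ (e.trans τ) h
  refine ⟨{ toBlossomData := fill σ (e.trans τ)
            rel_old := fun α β => ?_
            inDeg_two := fill_inDeg _ _ h
            outDeg_two := fill_outDeg _ _ h
            gentle := h'.isLocallyGentle
            label := fun p => ⟨w p, ?_⟩ }⟩
  · rw [h'.rel_iff', h.rel_iff']
    exact and_congr_left' Sum.inl.inj_iff
  · rw [BlossomData.isMaximalPath_iff]
    let m : (fill σ τ).quiver.E → (fill σ (e.trans τ)).quiver.E :=
      Sum.map id (Sum.map id e.symm)
    let mV : (fill σ τ).quiver.V → (fill σ (e.trans τ)).quiver.V :=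
      Sum.map id (Sum.map id e.symm)
    have hτ : ∀ p, τ (e (e.symm p)) = τ p := fun p => congrArg τ (e.apply_symm_apply p)
    have ht : ∀ x, (fill σ (e.trans τ)).quiver.t (m x) = mV ((fill σ τ).quiver.t x)
      | Sum.inl _ => rfl
      | Sum.inr (Sum.inl _) => rfl
      | Sum.inr (Sum.inr _) => rfl
    have hs : ∀ x, (fill σ (e.trans τ)).quiver.s (m x) = mV ((fill σ τ).quiver.s x)
      | Sum.inl _ => rfl
      | Sum.inr (Sum.inl _) => rfl
      | Sum.inr (Sum.inr p) => congrArg (fun z : FreeOut g =>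
          (Sum.inl z.1.1 : (fill σ (e.trans τ)).quiver.V)) (hτ p)
    have hF : ∀ x, slotIn σ (m x) = slotIn σ x
      | Sum.inl _ => rfl
      | Sum.inr (Sum.inl _) => rfl
      | Sum.inr (Sum.inr _) => rfl
    have hG : ∀ x, slotOut (e.trans τ) (m x) = slotOut τ x
      | Sum.inl _ => rfl
      | Sum.inr (Sum.inl _) => rfl
      | Sum.inr (Sum.inr p) => congrArg (fun z => z.1.2) (hτ p)
    have hm : ∀ x y, (fill σ τ).quiver.Nonzero x y →
        (fill σ (e.trans τ)).quiver.Nonzero (m x) (m y) := by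
      intro x y hxy
      rw [(isSlotting_fill σ τ h).nonzero_iff] at hxy
      exact h'.nonzero_iff.2 ⟨(ht x).trans ((congrArg mV hxy.1).trans (hs y).symm),
        (hF x).trans (hxy.2.trans (congrArg not (hG y)).symm)⟩
    have h2 : ((fill σ τ).sig p :: ((w p).map (fill σ τ).old ++ [(fill σ τ).tau (π p)])).map m =
        (fill σ (e.trans τ)).sig p ::
          ((w p).map (fill σ (e.trans τ)).old ++ [(fill σ (e.trans τ)).tau p]) := by
      have h3 : e.symm (π p) = p := e.symm_apply_apply p
      have h4 : m ((fill σ τ).tau (π p)) = (fill σ (e.trans τ)).tau p :=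
        congrArg (fun r => Sum.inr (Sum.inr r)) h3
      rw [List.map_cons, List.map_append, List.map_map, List.map_singleton, h4]
      rfl
    rw [← h2, List.isChain_map]
    exact (hw p).imp hm

end BoundQuiver

/-! ### The gentle repetition is gentle -/

theorem Cycle.length_map {α β : Type*} (f : α → β) (c : Cycle α) :
    (c.map f).length = c.length := by
  induction c using Quotient.inductionOn' with
  | h l => exact List.length_map _

theorem Cycle.nodup_map_of_injective {α β : Type*} {f : α → β} (hf : Function.Injective f)
    (c : Cycle α) : (c.map f).Nodup ↔ c.Nodup := by
  induction c using Quotient.inductionOn' with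
  | h l => exact List.nodup_map_iff hf

theorem Cycle.map_injective {α β : Type*} {f : α → β} (hf : Function.Injective f) :
    Function.Injective (Cycle.map f) := by
  intro c c' h
  induction c, c' using Quotient.inductionOn₂' with
  | h l l' =>
    obtain ⟨n, hn⟩ : (l.map f) ~r (l'.map f) := Quotient.exact h
    rw [← List.map_rotate] at hn
    exact Quotient.sound ⟨n, List.map_injective_iff.2 hf hn⟩

theorem Cycle.exists_map_eq {α β : Type*} {f : α → β} (c : Cycle β)
    (hc : ∀ b ∈ c, b ∈ Set.range f) : ∃ c' : Cycle α, c'.map f = c := by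
  induction c using Quotient.inductionOn' with
  | h l =>
    obtain ⟨l', rfl⟩ : l ∈ Set.range (List.map f) := by rw [Set.range_list_map]; exact hc
    exact ⟨(l' : Cycle α), rfl⟩

namespace BoundQuiver

namespace Blossoming

variable {B : BoundQuiver.{u, v}} (X : B.Blossoming) (k : ℕ)

theorem nonzero_old {α β : B.E} :
    X.quiver.Nonzero (X.old α) (X.old β) ↔ B.Nonzero α β :=
  and_congr Sum.inl.inj_iff (not_congr (X.rel_old α β))

/-- The connecting arrow `ϖ_p^{[i]}`, from sheet `i` to sheet `i + 1`. -/
def connecting (i : Fin (k - 1)) (p : Fin X.d) : (X.rep k).E := Sum.inr (i, p)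

theorem rep_arrow_cases (x : (X.rep k).E) :
    (∃ i α, x = X.repArrow k i α) ∨ ∃ i p, x = X.connecting k i p := by
  rcases x with ⟨i, α⟩ | ⟨i, p⟩
  · exact Or.inl ⟨i, α, rfl⟩
  · exact Or.inr ⟨i, p, rfl⟩

/-- The arrow of the blossoming of `B` which an arrow of the repetition looks like at its target:
a copy of `α` looks like `α`, and `ϖ_p` looks like `σ_p`. -/
def repIn : (X.rep k).E → X.quiver.E
  | Sum.inl (_, α) => X.old α
  | Sum.inr (_, p) => X.sig p

/-- The arrow of the blossoming of `B` which an arrow of the repetition looks like at its source: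
a copy of `α` looks like `α`, and `ϖ_p` looks like `τ_p`. -/
def repOut : (X.rep k).E → X.quiver.E
  | Sum.inl (_, α) => X.old α
  | Sum.inr (_, p) => X.tau p

theorem t_repIn : ∀ x : (X.rep k).E, X.quiver.t (X.repIn k x) = Sum.inl ((X.rep k).t x).2
  | Sum.inl _ => rfl
  | Sum.inr _ => rfl

theorem s_repOut : ∀ x : (X.rep k).E, X.quiver.s (X.repOut k x) = Sum.inl ((X.rep k).s x).2
  | Sum.inl _ => rfl
  | Sum.inr _ => rfl

theorem rep_ext_t : ∀ {x y : (X.rep k).E}, (X.rep k).t x = (X.rep k).t y →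
    X.repIn k x = X.repIn k y → x = y
  | Sum.inl _, Sum.inl _, h, h' =>
      congrArg Sum.inl (Prod.ext (Prod.ext_iff.1 h).1 (Sum.inl.inj h'))
  | Sum.inl _, Sum.inr _, _, h' => nomatch h'
  | Sum.inr _, Sum.inl _, _, h' => nomatch h'
  | Sum.inr _, Sum.inr _, h, h' =>
      congrArg Sum.inr (Prod.ext
        (Fin.ext (Nat.succ_injective (Fin.ext_iff.1 (Prod.ext_iff.1 h).1)))
        (Sum.inl.inj (Sum.inr.inj h')))

theorem rep_ext_s : ∀ {x y : (X.rep k).E}, (X.rep k).s x = (X.rep k).s y →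
    X.repOut k x = X.repOut k y → x = y
  | Sum.inl _, Sum.inl _, h, h' =>
      congrArg Sum.inl (Prod.ext (Prod.ext_iff.1 h).1 (Sum.inl.inj h'))
  | Sum.inl _, Sum.inr _, _, h' => nomatch h'
  | Sum.inr _, Sum.inl _, _, h' => nomatch h'
  | Sum.inr _, Sum.inr _, h, h' =>
      congrArg Sum.inr (Prod.ext
        (Fin.ext (congrArg (fun z : Fin k × B.V => (z.1 : ℕ)) h)) (Sum.inr.inj (Sum.inr.inj h')))

theorem rep_rel_iff : ∀ {x y : (X.rep k).E}, (X.rep k).t x = (X.rep k).s y →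
    ((X.rep k).rel x y ↔ X.quiver.rel (X.repIn k x) (X.repOut k y))
  | Sum.inl _, Sum.inl _, h =>
      (and_iff_right (Prod.ext_iff.1 h).1).trans (X.rel_old _ _).symm
  | Sum.inl _, Sum.inr _, h => and_iff_right (Fin.ext_iff.1 (Prod.ext_iff.1 h).1)
  | Sum.inr _, Sum.inl _, h => and_iff_right (Fin.ext_iff.1 (Prod.ext_iff.1 h).1)
  | Sum.inr _, Sum.inr _, h => and_iff_right (Fin.ext_iff.1 (Prod.ext_iff.1 h).1)

/-- A slotting of the blossoming of `B` induces one of the repetition, in each sheet the same. -/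
theorem isSlotting_rep {f g : X.quiver.E → Bool} (h : X.quiver.IsSlotting f g) :
    (X.rep k).IsSlotting (fun x => f (X.repIn k x)) (fun x => g (X.repOut k x)) where
  inj_t x y hxy he := X.rep_ext_t k hxy (h.inj_t (by rw [t_repIn, t_repIn, hxy]) he)
  inj_s x y hxy he := X.rep_ext_s k hxy (h.inj_s (by rw [s_repOut, s_repOut, hxy]) he)
  rel_iff x y hxy := by
    rw [X.rep_rel_iff k hxy, h.rel_iff (by rw [t_repIn, s_repOut, hxy])]

theorem repArrow_injective (i : Fin k) : Function.Injective (X.repArrow k i) :=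
  fun _ _ h => (Prod.ext_iff.1 (Sum.inl.inj h)).2

theorem rel_repArrow {i : Fin k} {α β : B.E} :
    (X.rep k).rel (X.repArrow k i α) (X.repArrow k i β) ↔ B.rel α β :=
  and_iff_right rfl

theorem nonzero_repArrow {i : Fin k} {α β : B.E} :
    (X.rep k).Nonzero (X.repArrow k i α) (X.repArrow k i β) ↔ B.Nonzero α β :=
  and_congr ⟨fun h => (Prod.ext_iff.1 h).2, fun h => Prod.ext rfl h⟩
    (not_congr (X.rel_repArrow k))

theorem sheet_le : ∀ x : (X.rep k).E, ((X.rep k).s x).1 ≤ ((X.rep k).t x).1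
  | Sum.inl _ => le_rfl
  | Sum.inr (i, _) => Nat.le_succ i

theorem exists_repArrow_of_sheet_le : ∀ x : (X.rep k).E, ((X.rep k).t x).1 ≤ ((X.rep k).s x).1 →
    ∃ α, X.repArrow k ((X.rep k).s x).1 α = x
  | Sum.inl (_, α), _ => ⟨α, rfl⟩
  | Sum.inr (i, _), h => absurd h (Nat.not_succ_le_self i)

/-- Arrows never lead to a lower sheet and connecting arrows lead to a higher one, so that a closed
path consists of the copies of old arrows in one sheet. -/
theorem exists_cycle_map_repArrow {R : (X.rep k).E → (X.rep k).E → Prop}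
    (hR : ∀ x y, R x y → (X.rep k).t x = (X.rep k).s y) {c : Cycle (X.rep k).E}
    (hnil : c ≠ Cycle.nil) (hc : c.Chain R) :
    ∃ (i : Fin k) (c' : Cycle B.E), c'.map (X.repArrow k i) = c := by
  let r : (X.rep k).E → (X.rep k).E → Prop := fun x y => ((X.rep k).t x).1 ≤ ((X.rep k).s y).1
  have : IsTrans _ r := ⟨fun x y z hxy hyz => (hxy.trans (X.sheet_le k y)).trans hyz⟩
  have hr : ∀ a ∈ c, ∀ b ∈ c, r a b :=
    Cycle.chain_iff_pairwise.1 (hc.imp fun x y hxy => by simp only [r]; rw [hR x y hxy])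
  obtain ⟨a, ha⟩ : ∃ a, a ∈ c := by
    induction c using Quotient.inductionOn' with
    | h l => exact List.exists_mem_of_ne_nil l fun h => hnil (by rw [h]; rfl)
  refine ⟨((X.rep k).s a).1, Cycle.exists_map_eq c fun b hb => ?_⟩
  obtain ⟨β, hβ⟩ := X.exists_repArrow_of_sheet_le k b (hr b hb b hb)
  have hab : ((X.rep k).s a).1 = ((X.rep k).s b).1 :=
    le_antisymm ((X.sheet_le k a).trans (hr a ha b hb))
      ((X.sheet_le k b).trans (hr b hb a ha))
  exact ⟨β, by rw [hab]; exact hβ⟩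

theorem isOrientedCycle_map_repArrow (i : Fin k) (c : Cycle B.E) :
    (X.rep k).IsOrientedCycle (c.map (X.repArrow k i)) ↔ B.IsOrientedCycle c := by
  unfold IsOrientedCycle
  rw [Ne, Cycle.map_eq_nil, Cycle.nodup_map_of_injective (X.repArrow_injective k i),
    Cycle.chain_map]
  simp only [nonzero_repArrow]

theorem isAnticycle_map_repArrow (i : Fin k) (c : Cycle B.E) :
    (X.rep k).IsAnticycle (c.map (X.repArrow k i)) ↔ B.IsAnticycle c := by
  unfold IsAnticycle
  rw [Ne, Cycle.map_eq_nil, Cycle.nodup_map_of_injective (X.repArrow_injective k i),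
    Cycle.chain_map]
  simp only [rel_repArrow]

theorem bijOn_anticycles (l : ℕ) : Set.BijOn
    (fun x : Fin k × Cycle B.E => x.2.map (X.repArrow k x.1))
    {x | B.IsAnticycle x.2 ∧ x.2.length = l}
    {c | (X.rep k).IsAnticycle c ∧ c.length = l} := by
  refine ⟨fun x hx => ⟨(X.isAnticycle_map_repArrow k _ _).2 hx.1, ?_⟩, ?_, ?_⟩
  · rw [Cycle.length_map]; exact hx.2
  · -- a nonempty cycle determines the sheet that it lies in
    rintro ⟨i, c⟩ hc ⟨j, c'⟩ - h
    obtain ⟨a, ha⟩ : ∃ a, a ∈ c := by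
      have hnil := hc.1.1
      clear h hc
      induction c using Quotient.inductionOn' with
      | h l => exact List.exists_mem_of_ne_nil l fun h => hnil (by simp only at h ⊢; rw [h]; rfl)
    have hij : i = j := by
      have h1 : X.repArrow k i a ∈ c.map (X.repArrow k i) := Cycle.mem_map.2 ⟨a, ha, rfl⟩
      simp only at h
      rw [h] at h1
      obtain ⟨b, -, hb⟩ := Cycle.mem_map.1 h1
      exact ((Prod.ext_iff.1 (Sum.inl.inj hb)).1).symm
    subst hij
    exact Prod.ext rfl (Cycle.map_injective (X.repArrow_injective k i) h)
  · rintro c ⟨hc, hl⟩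
    obtain ⟨i, c', rfl⟩ := X.exists_cycle_map_repArrow k (X.rep k).rel_comp hc.1 hc.2.2
    exact ⟨(i, c'), ⟨(X.isAnticycle_map_repArrow k i c').1 hc, by rwa [Cycle.length_map] at hl⟩,
      rfl⟩

/-- Without blossom arrows every arrow would have a nonzero continuation, and following these
continuations would give an oriented cycle. -/
theorem d_pos (hB : B.IsGentle) : 0 < X.d := by
  by_contra hd
  have : IsEmpty (Fin X.d) := ⟨fun p => hd (lt_of_le_of_lt (Nat.zero_le _) p.2)⟩
  obtain ⟨f, g, h⟩ := X.gentle.exists_isSlotting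
  have hsucc : ∀ α, ∃ β, B.Nonzero α β := by
    intro α
    obtain ⟨y, hy, hgy⟩ := h.exists_s_eq (X.outDeg_two (B.t α)) (!(f (X.old α)))
    obtain ⟨β, rfl⟩ | ⟨p, -⟩ | ⟨p, -⟩ := X.arrow_cases y
    · exact ⟨β, X.nonzero_old.1 (h.nonzero_iff.2 ⟨hy.symm, by rw [hgy, Bool.not_not]⟩)⟩
    · exact isEmptyElim p
    · exact isEmptyElim p
  choose N hN using hsucc
  have hinj : Function.Injective N := by
    intro α β hαβ
    have h1 := hN α
    rw [hαβ] at h1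
    exact hB.locallyGentle.pre_nonzero _ h1 (hN β)
  obtain ⟨α⟩ := hB.nonempty_arrows
  have hper := hinj.mem_periodicPts α
  refine hB.no_cycle (Function.periodicOrbit N α)
    ⟨fun h => Function.periodicOrbit_eq_nil_iff_not_periodic_pt.1 h hper,
      Function.nodup_periodicOrbit, ?_⟩
  rw [Function.periodicOrbit_chain' _ hper]
  intro n
  rw [Function.iterate_succ_apply']
  exact hN _

theorem isConnected_rep (hB : B.IsGentle) (hk : 0 < k) : (X.rep k).IsConnected := by
  let r : (X.rep k).V → (X.rep k).V → Prop := fun x y =>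
    ∃ α, (X.rep k).s α = x ∧ (X.rep k).t α = y
  have hsheet : ∀ (i : Fin k) (a b : B.V), Relation.EqvGen r (i, a) (i, b) := by
    intro i a b
    induction hB.connected.2 a b with
    | rel x y hxy =>
      obtain ⟨α, rfl, rfl⟩ := hxy
      exact .rel _ _ ⟨X.repArrow k i α, rfl, rfl⟩
    | refl x => exact .refl _
    | symm x y _ ih => exact ih.symm
    | trans x y z _ _ ih1 ih2 => exact ih1.trans _ _ _ ih2
  obtain ⟨a⟩ := hB.connected.1
  have hzero : ∀ (n : ℕ) (hn : n < k) (b : B.V),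
      Relation.EqvGen r (⟨0, hk⟩, a) (⟨n, hn⟩, b) := by
    intro n
    induction n with
    | zero => exact fun _ b => hsheet _ a b
    | succ n ih =>
      intro hn b
      let p : Fin X.d := ⟨0, X.d_pos hB⟩
      refine ((ih (by omega) (X.tauS p)).trans _ _ (⟨n + 1, hn⟩, X.sigT p) ?_).trans _ _ _
        (hsheet _ _ b)
      exact .rel _ _ ⟨X.connecting k ⟨n, by omega⟩ p, rfl, rfl⟩
  exact ⟨⟨(⟨0, hk⟩, a)⟩, fun x y => ((hzero _ x.1.2 x.2).symm).trans _ _ _ (hzero _ y.1.2 y.2)⟩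

theorem isGentle_rep (hB : B.IsGentle) (hk : 0 < k) : (X.rep k).IsGentle where
  connected := X.isConnected_rep k hB hk
  nonempty_arrows := hB.nonempty_arrows.map (X.repArrow k ⟨0, hk⟩)
  locallyGentle := by
    obtain ⟨f, g, h⟩ := X.gentle.exists_isSlotting
    exact (X.isSlotting_rep k h).isLocallyGentle
  no_cycle c hc := by
    obtain ⟨i, c', rfl⟩ := X.exists_cycle_map_repArrow k (fun _ _ h => h.1) hc.1 hc.2.2
    exact hB.no_cycle c' ((X.isOrientedCycle_map_repArrow k i c').1 hc)

end Blossoming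

end BoundQuiver

/-! ### Blossomings of the gentle repetition -/

namespace BoundQuiver

namespace Blossoming

variable {B : BoundQuiver.{u, v}} (X : B.Blossoming) (k : ℕ) (Y : (X.rep k).Blossoming)

/-- A comparison of a blossoming `Y` of the `k`-fold repetition with the blossoming `X` of `B` from
which the repetition is built: slottings of both which agree on all arrows of the repetition, and
bijections `eσ` and `eτ` which match each `σ_p` of `X` with a blossom arrow of `Y` occupying the
same incoming slot in the lowest sheet, and each `τ_p` of `X` with a blossom arrow of `Y` occupying
the same outgoing slot in the highest sheet. -/
structure Alignment where
  f : X.quiver.E → Bool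
  g : X.quiver.E → Bool
  F : Y.quiver.E → Bool
  G : Y.quiver.E → Bool
  slotting : X.quiver.IsSlotting f g
  slotting' : Y.quiver.IsSlotting F G
  F_old : ∀ x, F (Y.old x) = f (X.repIn k x)
  G_old : ∀ x, G (Y.old x) = g (X.repOut k x)
  eσ : Fin X.d ≃ Fin Y.d
  eτ : Fin X.d ≃ Fin Y.d
  eσ_fst : ∀ p, (Y.sigT (eσ p)).1.val = 0
  eσ_snd : ∀ p, (Y.sigT (eσ p)).2 = X.sigT p
  F_sig : ∀ p, F (Y.sig (eσ p)) = f (X.sig p)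
  eτ_fst : ∀ p, (Y.tauS (eτ p)).1.val = k - 1
  eτ_snd : ∀ p, (Y.tauS (eτ p)).2 = X.tauS p
  G_tau : ∀ p, G (Y.tau (eτ p)) = g (X.tau p)

variable {X k Y}

/-- The free incoming slots of the repetition are those of `B`, in the lowest sheet. -/
theorem exists_eσ (hk : 0 < k) {f g : X.quiver.E → Bool} {F G : Y.quiver.E → Bool}
    (h : X.quiver.IsSlotting f g) (h' : Y.quiver.IsSlotting F G)
    (hF : ∀ x, F (Y.old x) = f (X.repIn k x)) :
    ∃ e : Fin X.d ≃ Fin Y.d, ∀ p, (Y.sigT (e p)).1.val = 0 ∧ (Y.sigT (e p)).2 = X.sigT p ∧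
      F (Y.sig (e p)) = f (X.sig p) := by
  have key : ∀ p, ∃ q, (Y.sigT q).1.val = 0 ∧ (Y.sigT q).2 = X.sigT p ∧
      F (Y.sig q) = f (X.sig p) := by
    intro p
    obtain ⟨y, hy, hFy⟩ := h'.exists_t_eq
      (Y.inDeg_two (X.repVertex k ⟨0, hk⟩ (X.sigT p))) (f (X.sig p))
    obtain ⟨x, rfl⟩ | ⟨q, rfl⟩ | ⟨q, rfl⟩ := Y.arrow_cases y
    · -- the slot of `σ_p` is not occupied by an arrow of the repetition
      exfalso
      have hx : (X.rep k).t x = X.repVertex k ⟨0, hk⟩ (X.sigT p) := Sum.inl.inj hy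
      rw [hF] at hFy
      have h1 : X.repIn k x = X.sig p :=
        h.inj_t (by rw [t_repIn, hx]; rfl) hFy
      obtain ⟨i, α, rfl⟩ | ⟨i, r, rfl⟩ := X.rep_arrow_cases k x
      · exact X.sig_ne_old _ _ h1.symm
      · exact Nat.succ_ne_zero _ (Fin.ext_iff.1 (Prod.ext_iff.1 hx).1)
    · have hq : Y.sigT q = X.repVertex k ⟨0, hk⟩ (X.sigT p) := Sum.inl.inj hy
      exact ⟨q, by rw [hq]; rfl, by rw [hq]; rfl, hFy⟩
    · exact absurd hy Sum.inr_ne_inl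
  choose e he using key
  refine ⟨Equiv.ofBijective e ⟨?_, ?_⟩, he⟩
  · intro p q hpq
    refine X.sig_inj (h.inj_t ?_ ?_)
    · rw [BlossomData.t_sig, BlossomData.t_sig, ← (he p).2.1, ← (he q).2.1, hpq]
    · rw [← (he p).2.2, ← (he q).2.2, hpq]
  · intro q
    obtain ⟨x, hx, hfx⟩ := h.exists_t_eq (X.inDeg_two (Y.sigT q).2) (F (Y.sig q))
    -- the slot of a blossom arrow of `Y` is not occupied by an arrow of the repetition
    have hold : ∀ z : (X.rep k).E, (X.rep k).t z = Y.sigT q → X.repIn k z ≠ x := by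
      rintro z hz rfl
      refine Y.sig_ne_old q z (h'.inj_t ?_ ?_)
      · rw [BlossomData.t_sig, BlossomData.t_old, hz]
      · rw [hF, hfx]
    obtain ⟨α, rfl⟩ | ⟨p, rfl⟩ | ⟨p, rfl⟩ := X.arrow_cases x
    · exact absurd rfl (hold (X.repArrow k (Y.sigT q).1 α) (Prod.ext rfl (Sum.inl.inj hx)))
    · -- in a higher sheet, the slot of `σ_p` is occupied by a connecting arrow
      have hp : X.sigT p = (Y.sigT q).2 := Sum.inl.inj hx
      have h0 : (Y.sigT q).1.val = 0 := by
        by_contra h0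
        have hlt := (Y.sigT q).1.2
        exact hold (X.connecting k ⟨(Y.sigT q).1.val - 1, by omega⟩ p)
          (Prod.ext (Fin.ext (Nat.sub_add_cancel (Nat.pos_of_ne_zero h0))) hp) rfl
      refine ⟨p, Y.sig_inj (h'.inj_t ?_ ?_)⟩
      · exact congrArg Sum.inl
          (Prod.ext (Fin.ext ((he p).1.trans h0.symm)) ((he p).2.1.trans hp))
      · rw [(he p).2.2, hfx]
    · exact absurd hx Sum.inr_ne_inl

/-- The free outgoing slots of the repetition are those of `B`, in the highest sheet. -/
theorem exists_eτ (hk : 0 < k) {f g : X.quiver.E → Bool} {F G : Y.quiver.E → Bool}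
    (h : X.quiver.IsSlotting f g) (h' : Y.quiver.IsSlotting F G)
    (hG : ∀ x, G (Y.old x) = g (X.repOut k x)) :
    ∃ e : Fin X.d ≃ Fin Y.d, ∀ p, (Y.tauS (e p)).1.val = k - 1 ∧ (Y.tauS (e p)).2 = X.tauS p ∧
      G (Y.tau (e p)) = g (X.tau p) := by
  have key : ∀ p, ∃ q, (Y.tauS q).1.val = k - 1 ∧ (Y.tauS q).2 = X.tauS p ∧
      G (Y.tau q) = g (X.tau p) := by
    intro p
    obtain ⟨y, hy, hGy⟩ := h'.exists_s_eq
      (Y.outDeg_two (X.repVertex k ⟨k - 1, by omega⟩ (X.tauS p))) (g (X.tau p))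
    obtain ⟨x, rfl⟩ | ⟨q, rfl⟩ | ⟨q, rfl⟩ := Y.arrow_cases y
    · exfalso
      have hx : (X.rep k).s x = X.repVertex k ⟨k - 1, by omega⟩ (X.tauS p) := Sum.inl.inj hy
      rw [hG] at hGy
      have h1 : X.repOut k x = X.tau p :=
        h.inj_s (by rw [s_repOut, hx]; rfl) hGy
      obtain ⟨i, α, rfl⟩ | ⟨i, r, rfl⟩ := X.rep_arrow_cases k x
      · exact X.tau_ne_old _ _ h1.symm
      · exact i.2.ne (Fin.ext_iff.1 (Prod.ext_iff.1 hx).1)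
    · exact absurd hy Sum.inr_ne_inl
    · have hq : Y.tauS q = X.repVertex k ⟨k - 1, by omega⟩ (X.tauS p) := Sum.inl.inj hy
      exact ⟨q, by rw [hq]; rfl, by rw [hq]; rfl, hGy⟩
  choose e he using key
  refine ⟨Equiv.ofBijective e ⟨?_, ?_⟩, he⟩
  · intro p q hpq
    refine X.tau_inj (h.inj_s ?_ ?_)
    · rw [BlossomData.s_tau, BlossomData.s_tau, ← (he p).2.1, ← (he q).2.1, hpq]
    · rw [← (he p).2.2, ← (he q).2.2, hpq]
  · intro q
    obtain ⟨x, hx, hgx⟩ := h.exists_s_eq (X.outDeg_two (Y.tauS q).2) (G (Y.tau q))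
    have hold : ∀ z : (X.rep k).E, (X.rep k).s z = Y.tauS q → X.repOut k z ≠ x := by
      rintro z hz rfl
      refine Y.tau_ne_old q z (h'.inj_s ?_ ?_)
      · rw [BlossomData.s_tau, BlossomData.s_old, hz]
      · rw [hG, hgx]
    obtain ⟨α, rfl⟩ | ⟨p, rfl⟩ | ⟨p, rfl⟩ := X.arrow_cases x
    · exact absurd rfl (hold (X.repArrow k (Y.tauS q).1 α) (Prod.ext rfl (Sum.inl.inj hx)))
    · exact absurd hx Sum.inr_ne_inl
    · have hp : X.tauS p = (Y.tauS q).2 := Sum.inl.inj hx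
      have h0 : (Y.tauS q).1.val = k - 1 := by
        by_contra h0
        have hlt := (Y.tauS q).1.2
        exact hold (X.connecting k ⟨(Y.tauS q).1.val, by omega⟩ p)
          (Prod.ext (Fin.ext rfl) hp) rfl
      refine ⟨p, Y.tau_inj (h'.inj_s ?_ ?_)⟩
      · exact congrArg Sum.inl
          (Prod.ext (Fin.ext ((he p).1.trans h0.symm)) ((he p).2.1.trans hp))
      · rw [(he p).2.2, hgx]

variable (X Y) in
theorem nonempty_alignment (hk : 0 < k) : Nonempty (Alignment X k Y) := by
  obtain ⟨f, g, h⟩ := X.gentle.exists_isSlotting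
  obtain ⟨F₁, G₁, h₁⟩ := Y.gentle.exists_isSlotting
  have hrep := X.isSlotting_rep k h
  obtain ⟨F, G, h', hF, hG⟩ := h₁.exists_extend (Set.range Y.old)
    (f₀ := Sum.elim (fun x => f (X.repIn k x)) fun _ => true)
    (g₀ := Sum.elim (fun x => g (X.repOut k x)) fun _ => true)
    (by
      rintro _ ⟨x, rfl⟩ _ ⟨y, rfl⟩ hxy he
      exact congrArg Y.old (hrep.inj_t (Sum.inl.inj hxy) he))
    (by
      rintro _ ⟨x, rfl⟩ _ ⟨y, rfl⟩ hxy he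
      exact congrArg Y.old (hrep.inj_s (Sum.inl.inj hxy) he))
    (by
      rintro _ ⟨x, rfl⟩ _ ⟨y, rfl⟩ hxy
      exact (Y.rel_old x y).trans (hrep.rel_iff (Sum.inl.inj hxy)))
  have hF' : ∀ x, F (Y.old x) = f (X.repIn k x) := fun x => hF _ ⟨x, rfl⟩
  have hG' : ∀ x, G (Y.old x) = g (X.repOut k x) := fun x => hG _ ⟨x, rfl⟩
  obtain ⟨eσ, hσ⟩ := exists_eσ hk h h' hF'
  obtain ⟨eτ, hτ⟩ := exists_eτ hk h h' hG'
  exact ⟨⟨f, g, F, G, h, h', hF', hG', eσ, eτ, fun p => (hσ p).1, fun p => (hσ p).2.1,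
    fun p => (hσ p).2.2, fun p => (hτ p).1, fun p => (hτ p).2.1, fun p => (hτ p).2.2⟩⟩

namespace Alignment

variable (a : Alignment X k Y)

/-- The arrows of `Y` which stem from the blossom arrows of `X` labelled `p`, in their order: the
blossom arrow `σ` in the lowest sheet for `i = 0`, the connecting arrow to the sheet `i` for
`0 < i < k`, and the blossom arrow `τ` in the highest sheet for `i = k`. -/
def strand (i : ℕ) (p : Fin X.d) : Y.quiver.E :=
  if i = 0 then Y.sig (a.eσ p)
  else if h : i - 1 < k - 1 then Y.old (X.connecting k ⟨i - 1, h⟩ p)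
  else Y.tau (a.eτ p)

theorem strand_zero (p : Fin X.d) : a.strand 0 p = Y.sig (a.eσ p) := if_pos rfl

theorem strand_succ {i : ℕ} (h : i < k - 1) (p : Fin X.d) :
    a.strand (i + 1) p = Y.old (X.connecting k ⟨i, h⟩ p) := by
  simp [strand, h]

theorem strand_last (hk : 0 < k) (p : Fin X.d) : a.strand k p = Y.tau (a.eτ p) := by
  simp [strand, hk.ne']

/-- The arrow in place of `x` at the sheet `i` of `Y`: the strand labelled `p` enters the sheet in
place of `σ_p` and leaves it in place of `τ_p`. -/
def lift (i : Fin k) : X.quiver.E → Y.quiver.E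
  | Sum.inl α => Y.old (X.repArrow k i α)
  | Sum.inr (Sum.inl p) => a.strand i p
  | Sum.inr (Sum.inr p) => a.strand (i + 1) p

theorem lift_sig (i : Fin k) (p : Fin X.d) : a.lift i (X.sig p) = a.strand i p := rfl

theorem lift_tau (i : Fin k) (p : Fin X.d) : a.lift i (X.tau p) = a.strand (i + 1) p := rfl

theorem lift_t (i : Fin k) (x : X.quiver.E) (b : B.V) (hx : X.quiver.t x = Sum.inl b) :
    Y.quiver.t (a.lift i x) = Sum.inl (X.repVertex k i b) ∧ a.F (a.lift i x) = a.f x := by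
  obtain ⟨α, rfl⟩ | ⟨p, rfl⟩ | ⟨p, rfl⟩ := X.arrow_cases x
  · obtain rfl : B.t α = b := Sum.inl.inj hx
    exact ⟨rfl, a.F_old _⟩
  · obtain rfl : X.sigT p = b := Sum.inl.inj hx
    rw [lift_sig]
    obtain ⟨i, hi⟩ := i
    rcases i with _ | i
    · rw [strand_zero]
      exact ⟨congrArg Sum.inl (Prod.ext (Fin.ext (a.eσ_fst p)) (a.eσ_snd p)), a.F_sig p⟩
    · rw [a.strand_succ (show i < k - 1 by omega)]
      exact ⟨rfl, a.F_old _⟩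
  · exact absurd hx Sum.inr_ne_inl

theorem lift_s (i : Fin k) (x : X.quiver.E) (b : B.V) (hx : X.quiver.s x = Sum.inl b) :
    Y.quiver.s (a.lift i x) = Sum.inl (X.repVertex k i b) ∧ a.G (a.lift i x) = a.g x := by
  obtain ⟨α, rfl⟩ | ⟨p, rfl⟩ | ⟨p, rfl⟩ := X.arrow_cases x
  · obtain rfl : B.s α = b := Sum.inl.inj hx
    exact ⟨rfl, a.G_old _⟩
  · exact absurd hx Sum.inr_ne_inl
  · obtain rfl : X.tauS p = b := Sum.inl.inj hx
    rw [lift_tau]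
    obtain ⟨i, hi⟩ := i
    by_cases h : i < k - 1
    · rw [a.strand_succ h]
      exact ⟨rfl, a.G_old _⟩
    · obtain rfl : k = i + 1 := by omega
      rw [a.strand_last (Nat.succ_pos i)]
      exact ⟨congrArg Sum.inl (Prod.ext (Fin.ext (a.eτ_fst p)) (a.eτ_snd p)), a.G_tau p⟩

theorem lift_composable (i : Fin k) {x y : X.quiver.E} (h : X.quiver.t x = X.quiver.s y) :
    Y.quiver.t (a.lift i x) = Y.quiver.s (a.lift i y) ∧ a.F (a.lift i x) = a.f x ∧
      a.G (a.lift i y) = a.g y := by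
  obtain ⟨b, hb⟩ : ∃ b, X.quiver.t x = Sum.inl b := by
    obtain ⟨α, rfl⟩ | ⟨p, rfl⟩ | ⟨p, rfl⟩ := X.arrow_cases x
    · exact ⟨_, rfl⟩
    · exact ⟨_, rfl⟩
    · exact absurd h (X.t_tau_ne_s y p)
  have h1 := a.lift_t i x b hb
  have h2 := a.lift_s i y b (h.symm.trans hb)
  exact ⟨h1.1.trans h2.1.symm, h1.2, h2.2⟩

theorem rel_lift (i : Fin k) {x y : X.quiver.E} (h : X.quiver.rel x y) :
    Y.quiver.rel (a.lift i x) (a.lift i y) := by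
  have hxy := a.slotting.rel_iff'.1 h
  obtain ⟨h1, h2, h3⟩ := a.lift_composable i hxy.1
  exact a.slotting'.rel_iff'.2 ⟨h1, by rw [h2, h3, hxy.2]⟩

theorem nonzero_lift (i : Fin k) {x y : X.quiver.E} (h : X.quiver.Nonzero x y) :
    Y.quiver.Nonzero (a.lift i x) (a.lift i y) := by
  have hxy := a.slotting.nonzero_iff.1 h
  obtain ⟨h1, h2, h3⟩ := a.lift_composable i hxy.1
  exact a.slotting'.nonzero_iff.2 ⟨h1, by rw [h2, h3, hxy.2]⟩

/-- Chains of `X` from `σ_{ψ p}` to `τ_p`, lifted to the sheets `0, …, n`, join at the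
connecting arrows to a chain of `Y` whose label changes by `ψ` in each sheet. -/
theorem exists_chain_lift {R : X.quiver.E → X.quiver.E → Prop} {R' : Y.quiver.E → Y.quiver.E → Prop}
    (hR : ∀ (i : Fin k) {x y}, R x y → R' (a.lift i x) (a.lift i y))
    (ψ : Fin X.d → Fin X.d) (δ : Fin X.d → List B.E)
    (hδ : ∀ p, (X.sig (ψ p) :: ((δ p).map X.old ++ [X.tau p])).IsChain R) (n : ℕ) (hn : n < k) :
    ∀ p, ∃ l : List (X.rep k).E,
      l.length = ∑ j ∈ Finset.range (n + 1), (δ (ψ^[j] p)).length + n ∧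
      (a.strand 0 (ψ^[n + 1] p) :: (l.map Y.old ++ [a.strand (n + 1) p])).IsChain R' := by
  have hlift : ∀ (i : Fin k) p, (a.strand i (ψ p) ::
      (((δ p).map (X.repArrow k i)).map Y.old ++ [a.strand (i + 1) p])).IsChain R' := by
    intro i p
    have h1 : ((X.sig (ψ p) :: ((δ p).map X.old ++ [X.tau p])).map (a.lift i)).IsChain R' := by
      rw [List.isChain_map]
      exact (hδ p).imp fun x y h => hR i h
    rw [List.map_cons, List.map_append, List.map_map, List.map_singleton, lift_sig, lift_tau] at h1
    rw [List.map_map]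
    exact h1
  induction n with
  | zero => exact fun p => ⟨(δ p).map (X.repArrow k ⟨0, hn⟩), by simp, hlift ⟨0, hn⟩ p⟩
  | succ n ih =>
    intro p
    obtain ⟨l, hl, hchain⟩ := ih (by omega) (ψ p)
    have h2 := hlift ⟨n + 1, hn⟩ p
    rw [a.strand_succ (show n < k - 1 by omega)] at hchain
    simp only at h2
    rw [a.strand_succ (show n < k - 1 by omega)] at h2
    refine ⟨l ++ X.connecting k ⟨n, by omega⟩ (ψ p) ::
      (δ p).map (X.repArrow k ⟨n + 1, hn⟩), ?_, ?_⟩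
    · rw [Finset.sum_range_succ']
      simp only [List.length_append, List.length_cons, List.length_map, hl,
        Function.iterate_succ_apply, Function.iterate_zero, id_eq]
      omega
    · rw [← Function.iterate_succ_apply] at hchain
      rw [List.map_append, List.map_cons, List.append_assoc, List.cons_append, ← List.cons_append,
        List.isChain_split]
      refine ⟨?_, h2⟩
      simpa using hchain

/-- The two bijections of labels agree, since the lifts of a maximal path `σ_p ℘_p τ_p` to all
sheets join to a maximal path. -/
theorem eσ_eq_eτ (hk : 0 < k) : a.eσ = a.eτ := by
  ext p : 1
  choose w hw using X.label
  obtain ⟨l, -, hl⟩ := a.exists_chain_lift (fun i _ _ => a.nonzero_lift i) id w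
    (fun p => (hw p).1.2) (k - 1) (by omega) p
  rw [Nat.sub_add_cancel hk, a.strand_last hk, a.strand_zero, Function.iterate_id] at hl
  obtain ⟨w', hw'⟩ := Y.label (a.eσ p)
  exact Y.nonzero_chain_end_unique Y.gentle hw'.1.2 hl

theorem isDel_lift (hk : 0 < k) (p : Fin X.d) : ∃ l : List (X.rep k).E,
    l.length = ∑ j ∈ Finset.range k, (X.del (X.Phi^[j] p)).length + (k - 1) ∧
    Y.IsDel (a.eσ p) (a.eσ (X.Phi^[k] p)) l := by
  obtain ⟨l, hlen, hl⟩ := a.exists_chain_lift (fun i _ _ => a.rel_lift i) X.Phi X.del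
    (fun p => (X.isDel_phiFun p).1.2) (k - 1) (by omega) p
  rw [Nat.sub_add_cancel hk] at hlen hl
  rw [a.strand_last hk, a.strand_zero, ← a.eσ_eq_eτ hk] at hl
  exact ⟨l, hlen, (Y.isDel_iff _ _ _).2 hl⟩

theorem Phi_eσ (hk : 0 < k) (p : Fin X.d) : Y.Phi (a.eσ p) = a.eσ (X.Phi^[k] p) := by
  obtain ⟨l, -, hl⟩ := a.isDel_lift hk p
  exact (Y.isDel_unique (Y.isDel_phiFun (a.eσ p)) hl).1

theorem length_del_eσ (hk : 0 < k) (p : Fin X.d) : (Y.del (a.eσ p)).length =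
    ∑ j ∈ Finset.range k, (X.del (X.Phi^[j] p)).length + (k - 1) := by
  obtain ⟨l, hlen, hl⟩ := a.isDel_lift hk p
  rw [(Y.isDel_unique (Y.isDel_phiFun (a.eσ p)) hl).2, hlen]

end Alignment

/-- The labels of a blossoming of the `k`-fold repetition correspond to those of the blossoming `X`
in such a way that `Φ` for the repetition is the `k`-th power of `Φ` for `X`. -/
theorem exists_label_equiv (X : B.Blossoming) (hk : 0 < k) (Y : (X.rep k).Blossoming) :
    ∃ e : Fin X.d ≃ Fin Y.d,
      (∀ p, Y.sigT (e p) = X.repVertex k ⟨0, hk⟩ (X.sigT p) ∧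
        Y.tauS (e p) = X.repVertex k ⟨k - 1, Nat.sub_lt hk Nat.one_pos⟩ (X.tauS p)) ∧
      (∀ p, Y.Phi (e p) = e (X.Phi^[k] p)) ∧
      ∀ p, (Y.del (e p)).length =
        ∑ j ∈ Finset.range k, (X.del (X.Phi^[j] p)).length + (k - 1) := by
  obtain ⟨a⟩ := nonempty_alignment X Y hk
  refine ⟨a.eσ, fun p => ⟨Prod.ext (Fin.ext (a.eσ_fst p)) (a.eσ_snd p), ?_⟩, a.Phi_eσ hk,
    a.length_del_eσ hk⟩
  rw [a.eσ_eq_eτ hk]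
  exact Prod.ext (Fin.ext (a.eτ_fst p)) (a.eτ_snd p)

end Blossoming

end BoundQuiver

/-! ### Orbits of a power of a permutation -/

section Orbits

open Finset Function

/-- `O` is an orbit of the permutation `φ`. -/
def IsPermOrbit {ι : Type*} (φ : Equiv.Perm ι) (O : Finset ι) : Prop :=
  ∃ p, ∀ r, r ∈ O ↔ φ.SameCycle p r

namespace IsPermOrbit

variable {ι : Type*} {φ : Equiv.Perm ι} {O O' : Finset ι}

theorem mem_iff (h : IsPermOrbit φ O) {p r : ι} (hp : p ∈ O) : r ∈ O ↔ φ.SameCycle p r := by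
  obtain ⟨p₀, h⟩ := h
  have h1 := (h p).1 hp
  rw [h r]
  exact ⟨fun h2 => h1.symm.trans h2, fun h2 => h1.trans h2⟩

theorem nonempty (h : IsPermOrbit φ O) : O.Nonempty :=
  let ⟨p, hp⟩ := h
  ⟨p, (hp p).2 (Equiv.Perm.SameCycle.refl _ _)⟩

theorem eq_of_mem (h : IsPermOrbit φ O) (h' : IsPermOrbit φ O') {p : ι} (hp : p ∈ O)
    (hp' : p ∈ O') : O = O' := by
  ext r
  rw [h.mem_iff hp, h'.mem_iff hp']

end IsPermOrbit

variable {ι κ : Type*}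

theorem exists_isPermOrbit [Finite ι] (φ : Equiv.Perm ι) (p : ι) :
    ∃ O, IsPermOrbit φ O ∧ p ∈ O := by
  classical
  have := Fintype.ofFinite ι
  exact ⟨univ.filter (φ.SameCycle p), ⟨p, by simp⟩, by simp [Equiv.Perm.SameCycle.refl]⟩

theorem sameCycle_iff_exists_iterate [Finite ι] {φ : Equiv.Perm ι} {p r : ι} :
    φ.SameCycle p r ↔ ∃ j, φ^[j] p = r := by
  constructor
  · intro h
    obtain ⟨j, hj⟩ := h.exists_nat_pow_eq
    exact ⟨j, by rw [← hj, Equiv.Perm.iterate_eq_pow]⟩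
  · rintro ⟨j, rfl⟩
    exact ⟨j, by rw [zpow_natCast, Equiv.Perm.iterate_eq_pow]⟩

theorem minimalPeriod_perm_pos [Finite ι] (φ : Equiv.Perm ι) (p : ι) : 0 < minimalPeriod φ p :=
  minimalPeriod_pos_of_mem_periodicPts (φ.injective.mem_periodicPts p)

/-- An orbit is enumerated by the iterates up to the period of any of its elements. -/
theorem IsPermOrbit.eq_image [Finite ι] [DecidableEq ι] {φ : Equiv.Perm ι} {O : Finset ι}
    (h : IsPermOrbit φ O) {p : ι} (hp : p ∈ O) :
    O = (range (minimalPeriod φ p)).image fun j => φ^[j] p := by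
  ext r
  rw [h.mem_iff hp, sameCycle_iff_exists_iterate, mem_image]
  constructor
  · rintro ⟨j, rfl⟩
    exact ⟨j % minimalPeriod φ p, mem_range.2 (Nat.mod_lt _ (minimalPeriod_perm_pos φ p)),
      iterate_mod_minimalPeriod_eq⟩
  · rintro ⟨j, -, rfl⟩
    exact ⟨j, rfl⟩

theorem IsPermOrbit.sum_eq [Finite ι] {φ : Equiv.Perm ι} {O : Finset ι}
    (h : IsPermOrbit φ O) {p : ι} (hp : p ∈ O) (F : ι → ℕ) :
    ∑ r ∈ O, F r = ∑ j ∈ range (minimalPeriod φ p), F (φ^[j] p) := by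
  classical
  rw [h.eq_image hp, sum_image]
  intro i hi j hj hij
  exact iterate_injOn_Iio_minimalPeriod (mem_range.1 hi) (mem_range.1 hj) hij

theorem IsPermOrbit.card_eq [Finite ι] {φ : Equiv.Perm ι} {O : Finset ι}
    (h : IsPermOrbit φ O) {p : ι} (hp : p ∈ O) : O.card = minimalPeriod φ p := by
  rw [card_eq_sum_ones, h.sum_eq hp]
  simp

theorem sum_range_mul (F : ℕ → ℕ) (a b : ℕ) :
    ∑ i ∈ range (a * b), F i = ∑ m ∈ range a, ∑ j ∈ range b, F (m * b + j) := by
  induction a with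
  | zero => simp
  | succ a ih => rw [Nat.succ_mul, sum_range_add, ih, sum_range_succ]

theorem IsPermOrbit.exists_mem_of_subset_map {ψ : Equiv.Perm κ} {e : ι ≃ κ} {O : Finset ι}
    {O' : Finset κ} (hO' : IsPermOrbit ψ O') (hsub : O' ⊆ O.map e.toEmbedding) :
    ∃ p ∈ O, e p ∈ O' := by
  obtain ⟨r, hr⟩ := hO'.nonempty
  obtain ⟨p, hp, rfl⟩ := mem_map.1 (hsub hr)
  exact ⟨p, hp, hr⟩

variable {k : ℕ} {φ : Equiv.Perm ι} {ψ : Equiv.Perm κ} {e : ι ≃ κ}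
  (h : ∀ p, ψ (e p) = e (φ^[k] p))

include h

theorem iterate_conj (n : ℕ) (p : ι) : ψ^[n] (e p) = e ((φ^[k])^[n] p) := by
  induction n with
  | zero => rfl
  | succ n ih => rw [iterate_succ_apply', ih, h, iterate_succ_apply' φ^[k]]

theorem minimalPeriod_conj (hk : 0 < k) (p : ι) :
    minimalPeriod ψ (e p) = minimalPeriod φ p / (minimalPeriod φ p).gcd k := by
  rw [← minimalPeriod_iterate_eq_div_gcd hk.ne', minimalPeriod_eq_minimalPeriod_iff]
  intro n
  rw [IsPeriodicPt, IsPeriodicPt, IsFixedPt, IsFixedPt, iterate_conj h, e.apply_eq_iff_eq]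

theorem IsPermOrbit.subset_map [Finite ι] [Finite κ] {O : Finset ι} {O' : Finset κ}
    (hO : IsPermOrbit φ O) (hO' : IsPermOrbit ψ O') {p : ι} (hp : p ∈ O) (hp' : e p ∈ O') :
    O' ⊆ O.map e.toEmbedding := by
  intro r hr
  obtain ⟨j, rfl⟩ := sameCycle_iff_exists_iterate.1 ((hO'.mem_iff hp').1 hr)
  rw [iterate_conj h, ← iterate_mul]
  exact mem_map_of_mem _ ((hO.mem_iff hp).2 (sameCycle_iff_exists_iterate.2 ⟨_, rfl⟩))

theorem existsUnique_orbit_of_pow [Finite ι] [Finite κ] {O' : Finset κ} (hO' : IsPermOrbit ψ O') :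
    ∃! O : Finset ι, IsPermOrbit φ O ∧ O' ⊆ O.map e.toEmbedding := by
  obtain ⟨r, hr⟩ := hO'.nonempty
  obtain ⟨p, rfl⟩ := e.surjective r
  obtain ⟨O, hO, hp⟩ := exists_isPermOrbit φ p
  refine ⟨O, ⟨hO, hO.subset_map h hO' hp hr⟩, ?_⟩
  rintro O₁ ⟨hO₁, hsub⟩
  obtain ⟨p', hp', he⟩ := mem_map.1 (hsub hr)
  obtain rfl := e.injective he
  exact hO₁.eq_of_mem hO hp' hp

theorem IsPermOrbit.card_pow [Finite ι] [Finite κ] (hk : 0 < k) {O : Finset ι} {O' : Finset κ}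
    (hO : IsPermOrbit φ O) (hO' : IsPermOrbit ψ O') (hsub : O' ⊆ O.map e.toEmbedding) :
    O'.card = O.card / O.card.gcd k := by
  obtain ⟨p, hp, hr⟩ := hO'.exists_mem_of_subset_map hsub
  rw [hO'.card_eq hr, hO.card_eq hp, minimalPeriod_conj h hk]

/-- An orbit of `φ` with `q` elements is the disjoint union of orbits of `φ ^ k`, each with
`q / gcd q k` elements. -/
theorem IsPermOrbit.card_orbits_pow [Finite ι] [Finite κ] (hk : 0 < k) {O : Finset ι}
    (hO : IsPermOrbit φ O) :
    Nat.card {O' : Finset κ // IsPermOrbit ψ O' ∧ O' ⊆ O.map e.toEmbedding} =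
      O.card.gcd k := by
  classical
  have := Fintype.ofFinite κ
  set T : Finset (Finset κ) :=
    univ.filter fun O' => IsPermOrbit ψ O' ∧ O' ⊆ O.map e.toEmbedding with hT
  have hmem : ∀ O', O' ∈ T ↔ IsPermOrbit ψ O' ∧ O' ⊆ O.map e.toEmbedding := by simp [hT]
  have hunion : T.biUnion id = O.map e.toEmbedding := by
    ext r
    simp only [mem_biUnion, id_eq, hmem]
    constructor
    · rintro ⟨O', ⟨-, hsub⟩, hr⟩
      exact hsub hr
    · intro hr
      obtain ⟨O', hO', hr'⟩ := exists_isPermOrbit ψ r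
      obtain ⟨p, hp, rfl⟩ := mem_map.1 hr
      exact ⟨O', ⟨hO', hO.subset_map h hO' hp hr'⟩, hr'⟩
  have hdisj : (T : Set (Finset κ)).PairwiseDisjoint id := by
    intro O₁ h₁ O₂ h₂ hne
    refine disjoint_left.2 fun r hr₁ hr₂ => hne ?_
    exact ((hmem _).1 h₁).1.eq_of_mem ((hmem _).1 h₂).1 hr₁ hr₂
  have hcard : O.card = T.card * (O.card / O.card.gcd k) := by
    have h1 := card_biUnion hdisj
    rw [hunion, card_map] at h1
    exact h1.trans (sum_const_nat fun O' hO' =>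
      hO.card_pow h hk ((hmem _).1 hO').1 ((hmem _).1 hO').2)
  rw [Nat.card_eq_fintype_card, Fintype.card_subtype, ← hT]
  have hpos : 0 < O.card / O.card.gcd k :=
    Nat.div_pos (Nat.gcd_le_left k hO.nonempty.card_pos) (Nat.gcd_pos_of_pos_right _ hk)
  refine Nat.eq_of_mul_eq_mul_right hpos (hcard.symm.trans ?_)
  exact (Nat.mul_div_cancel' (Nat.gcd_dvd_left _ _)).symm

/-- The blocks of `k` consecutive iterates starting at the elements of an orbit of `φ ^ k` run
`k / gcd q k` times through the orbit of `φ`. -/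
theorem IsPermOrbit.sum_pow [Finite ι] [Finite κ] (hk : 0 < k) {O : Finset ι} {O' : Finset κ}
    (hO : IsPermOrbit φ O) (hO' : IsPermOrbit ψ O') (hsub : O' ⊆ O.map e.toEmbedding)
    (F : ι → ℕ) (F' : κ → ℕ) (c : ℕ)
    (hF : ∀ p, F' (e p) = ∑ j ∈ range k, F (φ^[j] p) + c) :
    ∑ r ∈ O', F' r = k / O.card.gcd k * ∑ p ∈ O, F p + O.card / O.card.gcd k * c := by
  obtain ⟨p, hp, hr⟩ := hO'.exists_mem_of_subset_map hsub
  have hblock : ∑ m ∈ range (minimalPeriod φ p / (minimalPeriod φ p).gcd k),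
      ∑ j ∈ range k, F (φ^[j] ((φ^[k])^[m] p)) =
      k / (minimalPeriod φ p).gcd k * ∑ j ∈ range (minimalPeriod φ p), F (φ^[j] p) := by
    have h1 : ∀ m j, F (φ^[j] ((φ^[k])^[m] p)) = F (φ^[m * k + j] p) := by
      intro m j
      rw [← iterate_mul, ← iterate_add_apply, add_comm j, mul_comm k]
    have h2 : ∀ m j, F (φ^[m * minimalPeriod φ p + j] p) = F (φ^[j] p) := by
      intro m j
      rw [add_comm, iterate_add_apply, ((isPeriodicPt_minimalPeriod φ p).const_mul m).eq]
    have h3 : minimalPeriod φ p / (minimalPeriod φ p).gcd k * k =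
        k / (minimalPeriod φ p).gcd k * minimalPeriod φ p := by
      rw [Nat.div_mul_right_comm (Nat.gcd_dvd_left _ _), Nat.div_mul_right_comm
        (Nat.gcd_dvd_right _ _), mul_comm]
    simp only [h1]
    rw [← sum_range_mul (fun i => F (φ^[i] p)), h3, sum_range_mul]
    simp only [h2, sum_const, card_range, smul_eq_mul]
  rw [hO'.sum_eq hr, hO.sum_eq hp, minimalPeriod_conj h hk, hO.card_eq hp]
  simp only [iterate_conj h, hF]
  rw [sum_add_distrib, hblock, sum_const, card_range, smul_eq_mul]

end Orbits

/-! ### The invariants of the gentle repetition -/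

theorem repType_eq {k q l : ℕ} (hq : 0 < q) (hk : 0 < k) :
    repType k q l = (q / q.gcd k, k / q.gcd k * l + q / q.gcd k * (k - 1)) := by
  have h1 : q.lcm k / k = q / q.gcd k := by
    rw [Nat.lcm, Nat.div_div_eq_div_mul, Nat.mul_div_mul_right _ _ hk]
  have h2 : q.lcm k / q = k / q.gcd k := by
    rw [Nat.lcm, Nat.div_div_eq_div_mul, mul_comm (q.gcd k), Nat.mul_div_mul_left _ _ hq]
  rw [repType, h1, h2]

theorem finite_repTypeSet {k : ℕ} (hk : 0 < k) (n m : ℕ) : (repTypeSet k n m).Finite := by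
  refine ((Set.finite_Iic (n * k)).prod (Set.finite_Iic m)).subset ?_
  rintro ⟨q, l⟩ ⟨hq, h⟩
  simp only at hq h
  rw [repType, Prod.mk.injEq] at h
  have hpos := Nat.lcm_pos hq hk
  have h1 : q.lcm k = n * k := by rw [h.1, Nat.div_mul_cancel (Nat.dvd_lcm_right q k)]
  have h2 : 0 < q.lcm k / q := Nat.div_pos (Nat.le_of_dvd hpos (Nat.dvd_lcm_left q k)) hq
  refine ⟨?_, ?_⟩
  · exact h1 ▸ Nat.le_of_dvd hpos (Nat.dvd_lcm_left q k)
  · have := Nat.le_mul_of_pos_left l h2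
    change l ≤ m
    omega

namespace BoundQuiver

namespace Blossoming

variable {B : BoundQuiver.{u, v}}

theorem phi_of_pos (X : B.Blossoming) {q : ℕ} (hq : 0 < q) (l : ℕ) :
    X.phi q l = Nat.card {O : Finset (Fin X.d) // X.IsAGOrbit O ∧ X.type O = (q, l)} :=
  if_neg hq.ne'

variable (X : B.Blossoming) {k : ℕ} (Y : (X.rep k).Blossoming)

theorem phi_zero_rep (l : ℕ) : Y.phi 0 l = k * X.phi 0 l := by
  have h1 := Nat.card_congr (X.bijOn_anticycles k l).equiv
  have h2 : Nat.card {x : Fin k × Cycle B.E | B.IsAnticycle x.2 ∧ x.2.length = l} =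
      k * Nat.card {c : Cycle B.E // B.IsAnticycle c ∧ c.length = l} := by
    let E : {x : Fin k × Cycle B.E | B.IsAnticycle x.2 ∧ x.2.length = l} ≃
        Fin k × {c : Cycle B.E // B.IsAnticycle c ∧ c.length = l} :=
      { toFun := fun x => (x.1.1, ⟨x.1.2, x.2⟩)
        invFun := fun x => ⟨(x.1, x.2.1), x.2.2⟩
        left_inv := fun _ => rfl
        right_inv := fun _ => rfl }
    rw [Nat.card_congr E, Nat.card_prod, Nat.card_fin]
  rw [phi, phi, if_pos rfl, if_pos rfl, ← h2, h1]
  rfl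

open Finset in
/-- If the orbits in `X` split into orbits in `Y` in the given way, then counting the latter by the
former gives the formula for the invariants. -/
theorem phi_rep_of_orbits (e : Fin X.d ≃ Fin Y.d)
    (hcard : ∀ O : Finset (Fin X.d), X.IsAGOrbit O →
      Nat.card {O' : Finset (Fin Y.d) // Y.IsAGOrbit O' ∧ O' ⊆ O.map e.toEmbedding} =
        O.card.gcd k)
    (htype : ∀ O : Finset (Fin X.d), X.IsAGOrbit O → ∀ O' : Finset (Fin Y.d), Y.IsAGOrbit O' →
      O' ⊆ O.map e.toEmbedding → Y.type O' = repType k (X.type O).1 (X.type O).2)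
    (hunique : ∀ O' : Finset (Fin Y.d), Y.IsAGOrbit O' →
      ∃! O : Finset (Fin X.d), X.IsAGOrbit O ∧ O' ⊆ O.map e.toEmbedding)
    (hfin : ∀ n m, (repTypeSet k n m).Finite) {n : ℕ} (hn : 0 < n) (m : ℕ) :
    Y.phi n m = ∑ᶠ x ∈ repTypeSet k n m, Nat.gcd x.1 k * X.phi x.1 x.2 := by
  classical
  set S := (hfin n m).toFinset with hS
  have hSmem : ∀ x, x ∈ S ↔ 0 < x.1 ∧ (n, m) = repType k x.1 x.2 := fun x => by
    rw [hS, Set.Finite.mem_toFinset]; rfl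
  let 𝒪 : Finset (Finset (Fin X.d)) := univ.filter fun O => X.IsAGOrbit O ∧ X.type O ∈ S
  let D : Finset (Fin X.d) → Finset (Finset (Fin Y.d)) := fun O =>
    univ.filter fun O' => Y.IsAGOrbit O' ∧ O' ⊆ O.map e.toEmbedding
  have hT : (univ.filter fun O' => Y.IsAGOrbit O' ∧ Y.type O' = (n, m)) = 𝒪.biUnion D := by
    ext O'
    simp only [mem_filter, mem_univ, true_and, mem_biUnion, 𝒪, D]
    constructor
    · rintro ⟨hO', ht⟩
      obtain ⟨O, ⟨hO, hsub⟩, -⟩ := hunique O' hO'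
      refine ⟨O, ⟨hO, (hSmem _).2 ⟨?_, ?_⟩⟩, hO', hsub⟩
      · exact (show IsPermOrbit X.Phi O from hO).nonempty.card_pos
      · rw [← ht, htype O hO O' hO' hsub]
    · rintro ⟨O, ⟨hO, ht⟩, hO', hsub⟩
      exact ⟨hO', by rw [htype O hO O' hO' hsub, ← ((hSmem _).1 ht).2]⟩
  have hdisj : (𝒪 : Set (Finset (Fin X.d))).PairwiseDisjoint D := by
    intro O₁ h₁ O₂ h₂ hne
    refine disjoint_left.2 fun O' h₁' h₂' => hne ?_
    simp only [coe_filter, mem_univ, true_and, Set.mem_ofPred_eq, mem_filter, 𝒪, D] at h₁ h₂ h₁' h₂'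
    exact (hunique O' h₁'.1).unique ⟨h₁.1, h₁'.2⟩ ⟨h₂.1, h₂'.2⟩
  rw [finsum_mem_eq_finite_toFinset_sum _ (hfin n m), ← hS, Y.phi_of_pos hn,
    Nat.card_eq_fintype_card, Fintype.card_subtype, hT, card_biUnion hdisj]
  have hmaps : ∀ O ∈ 𝒪, X.type O ∈ S := fun O hO => (mem_filter.1 hO).2.2
  rw [← sum_fiberwise_of_maps_to hmaps]
  refine sum_congr rfl fun x hx => ?_
  rw [X.phi_of_pos ((hSmem x).1 hx).1, Nat.card_eq_fintype_card, Fintype.card_subtype, mul_comm]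
  have hfib : (𝒪.filter fun O => X.type O = x) =
      univ.filter fun O => X.IsAGOrbit O ∧ X.type O = (x.1, x.2) := by
    ext O
    simp only [mem_filter, mem_univ, true_and, 𝒪]
    exact ⟨fun h => ⟨h.1.1, h.2⟩, fun h => ⟨⟨h.1, h.2 ▸ hx⟩, h.2⟩⟩
  rw [hfib]
  refine sum_const_nat fun O hO => ?_
  have hO' := (mem_filter.1 hO).2
  have := hcard O hO'.1
  rw [Nat.card_eq_fintype_card, Fintype.card_subtype] at this
  rw [this]
  exact congrArg (fun z => Nat.gcd z.1 k) hO'.2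

end Blossoming

end BoundQuiver

theorem mainTheorem1 (A : BoundQuiver.{u, v}) (hA : A.IsGentle) (k : ℕ) (hk : 0 < k) :
    Nonempty A.Blossoming ∧
    ∀ X : A.Blossoming,
      (X.rep k).IsGentle ∧ Nonempty (X.rep k).Blossoming ∧
      ∀ Y : (X.rep k).Blossoming,
        -- anticycles of the repetition are exactly the `k` copies of the anticycles of `A`
        (∀ l : ℕ, Set.BijOn
          (fun x : Fin k × Cycle A.E => x.2.map (X.repArrow k x.1))
          {x | A.IsAnticycle x.2 ∧ x.2.length = l}
          {c | (X.rep k).IsAnticycle c ∧ c.length = l}) ∧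
        -- the AG-orbits of the repetition, under the identification of the blossom labels
        (∃ e : Fin X.d ≃ Fin Y.d,
          (∀ p, Y.sigT (e p) = X.repVertex k ⟨0, hk⟩ (X.sigT p) ∧
            Y.tauS (e p) = X.repVertex k ⟨k - 1, Nat.sub_lt hk Nat.one_pos⟩ (X.tauS p)) ∧
          (∀ (O : Finset (Fin X.d)) (q l : ℕ), X.IsAGOrbit O → X.type O = (q, l) →
            Nat.card {O' : Finset (Fin Y.d) // Y.IsAGOrbit O' ∧ O' ⊆ O.map e.toEmbedding} =
                Nat.gcd q k ∧
              ∀ O' : Finset (Fin Y.d), Y.IsAGOrbit O' → O' ⊆ O.map e.toEmbedding →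
                Y.type O' = repType k q l) ∧
          (∀ O' : Finset (Fin Y.d), Y.IsAGOrbit O' →
            ∃! O : Finset (Fin X.d), X.IsAGOrbit O ∧ O' ⊆ O.map e.toEmbedding)) ∧
        -- the formulas for the AG-invariants
        (∀ n m : ℕ, 0 < n → (repTypeSet k n m).Finite ∧
          Y.phi n m = ∑ᶠ x ∈ repTypeSet k n m, Nat.gcd x.1 k * X.phi x.1 x.2) ∧
        (∀ l : ℕ, Y.phi 0 l = k * X.phi 0 l) := by
  refine ⟨hA.locallyGentle.nonempty_blossoming, fun X => ?_⟩
  have hrep := X.isGentle_rep k hA hk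
  refine ⟨hrep, hrep.locallyGentle.nonempty_blossoming, fun Y => ?_⟩
  obtain ⟨e, hvert, hPhi, hdel⟩ := X.exists_label_equiv hk Y
  have hcard : ∀ O : Finset (Fin X.d), X.IsAGOrbit O →
      Nat.card {O' : Finset (Fin Y.d) // Y.IsAGOrbit O' ∧ O' ⊆ O.map e.toEmbedding} =
        O.card.gcd k :=
    fun O hO => IsPermOrbit.card_orbits_pow hPhi hk hO
  have htype : ∀ O : Finset (Fin X.d), X.IsAGOrbit O → ∀ O' : Finset (Fin Y.d),
      Y.IsAGOrbit O' → O' ⊆ O.map e.toEmbedding →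
        Y.type O' = repType k (X.type O).1 (X.type O).2 := by
    intro O hO O' hO' hsub
    have hO₁ : IsPermOrbit X.Phi O := hO
    have hO₁' : IsPermOrbit Y.Phi O' := hO'
    rw [repType_eq (show 0 < (X.type O).1 from hO₁.nonempty.card_pos) hk]
    exact Prod.ext (hO₁.card_pow hPhi hk hO₁' hsub)
      (hO₁.sum_pow hPhi hk hO₁' hsub (fun p => (X.del p).length) _ (k - 1) hdel)
  have hunique : ∀ O' : Finset (Fin Y.d), Y.IsAGOrbit O' →
      ∃! O : Finset (Fin X.d), X.IsAGOrbit O ∧ O' ⊆ O.map e.toEmbedding :=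
    fun O' hO' => existsUnique_orbit_of_pow hPhi hO'
  refine ⟨X.bijOn_anticycles k, ⟨e, hvert, fun O q l hO hql => ⟨?_, fun O' hO' hsub => ?_⟩,
    hunique⟩, fun n m hn => ⟨finite_repTypeSet hk n m, ?_⟩, X.phi_zero_rep Y⟩
  · rw [hcard O hO]
    exact congrArg (fun z => Nat.gcd z.1 k) hql
  · rw [htype O hO O' hO' hsub, hql]
  · exact X.phi_rep_of_orbits Y e hcard htype hunique (finite_repTypeSet hk) hn m
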